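/- Identify $\mathbb{R}^2$ with $\mathbb{C}$. Let a planar vector field $X$ be defined on an open neighbourhood $U$ of $0$ and let $\varphi(t;z,\bar z)$ denote its flow, i.e. the solution of $\dot z=X(z,\bar z)$ in $U$ with initial value $z$. For a map $F$, write $\varphi(1;z,\bar z)=F(z,\bar z)+O(n+1)$ to mean that for all $z$ near $0$ the solution exists on $[0,1]$ and $|\varphi(1;z,\bar z)-F(z,\bar z)|\le C|z|^{n+1}$ for some constant $C$. (i) Let $\alpha\in(0,2\pi)$ be such that $e^{i\alpha}$ is not a root of unity, and let $F(z,\bar z)=e^{i\alpha}z+\sum_{2\le j+k\le N}f_{j,k}z^j\bar z^k$ be a polynomial map with complex coefficients (of any degree). Then for every $n\ge 2$ there is a unique polynomial vector field of the form $X(z,\bar z)=i\alpha z+\sum_{2\le j+k\le n}a_{j,k}z^j\bar z^k$, $a_{j,k}\in\mathbb{C}$, (on $U=\mathbb{C}$) whose flow satisfies $\varphi(1;z,\bar z)=F(z,\bar z)+O(n+1)$. (ii) For every $n\ge 2$ there is a map $F(z,\bar z)=e^{i\alpha}z+\sum_{2\le j+k\le n}f_{j,k}z^j\bar z^k$ with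 $\alpha=2\pi/(n+1)$, namely $F(z,\bar z)=e^{2\pi i/(n+1)}z+\bar z^n$, such that there is no vector field $X$ of class $\mathcal{C}^{n+1}$ on an open neighbourhood $U$ of $0$ whose flow satisfies $\varphi(1;z,\bar z)=F(z,\bar z)+O(n+1)$. -/

import Mathlib

open scoped Topology ComplexConjugate

/-- The pairs of exponents `(j, k)` with `2 ≤ j + k ≤ n`. -/
def nonlinearExponents (n : ℕ) : Finset (ℕ × ℕ) :=
  (Finset.range (n + 1) ×ˢ Finset.range (n + 1)).filter
    fun p => 2 ≤ p.1 + p.2 ∧ p.1 + p.2 ≤ n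

/-- The planar polynomial map `z ↦ c z + ∑_{2 ≤ j + k ≤ n} a_{j,k} z^j z̄^k`. -/
noncomputable def planarPoly (c : ℂ) (n : ℕ) (a : nonlinearExponents n → ℂ) (z : ℂ) : ℂ :=
  c * z + ∑ p : nonlinearExponents n, a p * z ^ p.1.1 * conj z ^ p.1.2

/-- The polynomial vector field `iα z + ∑_{2 ≤ j + k ≤ n} a_{j,k} z^j z̄^k`. -/
noncomputable def ellipticField (α : ℝ) (n : ℕ) (a : nonlinearExponents n → ℂ) : ℂ → ℂ :=
  planarPoly (Complex.I * α) n a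

/-- The polynomial map `e^{iα} z + ∑_{2 ≤ j + k ≤ n} f_{j,k} z^j z̄^k`. -/
noncomputable def ellipticMap (α : ℝ) (n : ℕ) (f : nonlinearExponents n → ℂ) : ℂ → ℂ :=
  planarPoly (Complex.exp (Complex.I * α)) n f

/-- `φ` is, for initial points near the origin and times in `[0, 1]`, the flow of the
planar vector field `X` on the region `U`: `t ↦ φ t z` is the solution of `ż = X(z)` in `U` that
starts at `z` (for a `C¹` field `X` on an open `U` it is unique). -/
def IsUnitTimeFlowNearZero (U : Set ℂ) (X : ℂ → ℂ) (φ : ℝ → ℂ → ℂ) : Prop :=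
  ∀ᶠ z in 𝓝 (0 : ℂ), φ 0 z = z ∧ (∀ t ∈ Set.Icc (0 : ℝ) 1, φ t z ∈ U) ∧
    IsIntegralCurveOn (fun t => φ t z) (fun _ => X) (Set.Icc 0 1)

/-- The flow of the vector field `X` on `U` satisfies `φ(1; z) = F(z) + O(|z|^(n+1))` near `0`. -/
def TimeOneMapAgreesToOrder (U : Set ℂ) (X F : ℂ → ℂ) (n : ℕ) : Prop :=
  ∃ φ : ℝ → ℂ → ℂ, IsUnitTimeFlowNearZero U X φ ∧
    (fun z => φ 1 z - F z) =O[𝓝 (0 : ℂ)] fun z => ‖z‖ ^ (n + 1)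

section

open Set (Icc Ico Ioo Ioi Ici univ)
open Filter Asymptotics MeasureTheory

/-! Both parts rest on one perturbation formula, `IsUnitFlow.isBigO_sub_homPoly`. Write a field as
`l z + R(z)` with `R` quadratically small. In the rotating coordinate `exp(-lt) φ` the linear term
disappears, and the time derivative is `exp(-lt) R(φ)`. If two such fields first differ in degree `m
+ 1`, by `∑ c_{j,k} z^j z̄^k`, then Grönwall's inequality allows the orbits in this difference to be
replaced by the linear flow. The time-one maps therefore first differ in the same degree, by `exp(l)
∑ c_{j,k} ρ_{j,k} z^j z̄^k`, where `ρ_{j,k} = ∫₀¹ exp((l j + l̄ k - l) s) ds` is the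
`resonanceFactor`.

For `l = iα` the exponent is `iα (j - k - 1) s`. If `exp(iα)` is not a root of unity, no `ρ_{j,k}`
vanishes. The field can then be corrected degree by degree to produce any prescribed map, and its
coefficients are recovered in the same order. Existence also uses that the time-one map has a Taylor
polynomial, obtained by Picard iteration (`IsUnitFlow.exists_isPolyFamily`), so that the remaining
error has a homogeneous leading part.

In the resonant case the linear part of `X` is not given. With `w = exp(2πi/(n+1))`, the origin is
an isolated fixed point of the time-one map, which forces `X 0 = 0` (`field_zero_eq_zero`). The
linear part `A` satisfies `exp A = w` and so commutes with multiplication by the non-real number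
`w`; hence `A` is complex linear (`IsUnitFlow.linear_apply_eq_mul`), and its multiplier is
`2πi/(n+1)` modulo `2πi`. Below degree `n` all resonance factors are nonzero, so `R` has no terms
there. In degree `n` the factor of `z̄^n` is zero, so no field can produce this term. -/

/-- Finite sums of monomials `c(t) z^j z̄^k` with coefficients continuous in the time `t`. -/
inductive IsPolyFamily : (ℝ → ℂ → ℂ) → Prop
  | monomial (c : ℝ → ℂ) (j k : ℕ) (hc : Continuous c) :
      IsPolyFamily fun t z => c t * z ^ j * conj z ^ k
  | add {f g : ℝ → ℂ → ℂ} : IsPolyFamily f → IsPolyFamily g →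
      IsPolyFamily fun t z => f t z + g t z

/-- Polynomials in `z` and `z̄`. -/
def IsPlanarPoly (f : ℂ → ℂ) : Prop := IsPolyFamily fun _ => f

/-- The homogeneous polynomial `∑_{j + k = m} c_{j,k} z^j z̄^k`. -/
noncomputable def homPoly (m : ℕ) (c : ℕ × ℕ → ℂ) (z : ℂ) : ℂ :=
  ∑ p ∈ Finset.HasAntidiagonal.antidiagonal m, c p * z ^ p.1 * conj z ^ p.2

/-! ### Closure properties of polynomials with time-dependent coefficients -/

namespace IsPolyFamily

lemma congr {f g : ℝ → ℂ → ℂ} (hf : IsPolyFamily f) (h : ∀ t z, f t z = g t z) :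
    IsPolyFamily g := by
  have : f = g := by ext t z; exact h t z
  exact this ▸ hf

lemma coeff {c : ℝ → ℂ} (hc : Continuous c) : IsPolyFamily fun t _ => c t :=
  (monomial c 0 0 hc).congr (by simp)

lemma var : IsPolyFamily fun _ z => z :=
  (monomial (fun _ => 1) 1 0 continuous_const).congr (by simp)

lemma mul {f g : ℝ → ℂ → ℂ} (hf : IsPolyFamily f) (hg : IsPolyFamily g) :
    IsPolyFamily fun t z => f t z * g t z := by
  induction hf with
  | add _ _ h1 h2 => exact (h1.add h2).congr fun t z => by ring
  | monomial c j k hc =>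
    induction hg with
    | add _ _ h1 h2 => exact (h1.add h2).congr fun t z => by ring
    | monomial c' j' k' hc' =>
      exact (monomial (fun t => c t * c' t) (j + j') (k + k') (hc.mul hc')).congr
        fun t z => by ring

lemma coeff_mul {f : ℝ → ℂ → ℂ} (hf : IsPolyFamily f) {c : ℝ → ℂ} (hc : Continuous c) :
    IsPolyFamily fun t z => c t * f t z :=
  (coeff hc).mul hf

lemma pow {f : ℝ → ℂ → ℂ} (hf : IsPolyFamily f) (n : ℕ) :
    IsPolyFamily fun t z => f t z ^ n := by
  induction n with
  | zero => exact (coeff (continuous_const (y := (1 : ℂ)))).congr (by simp)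
  | succ n ih => exact (ih.mul hf).congr fun t z => by ring

lemma conj' {f : ℝ → ℂ → ℂ} (hf : IsPolyFamily f) :
    IsPolyFamily fun t z => conj (f t z) := by
  induction hf with
  | add _ _ h1 h2 => exact (h1.add h2).congr fun t z => by simp
  | monomial c j k hc =>
    exact (monomial (fun t => conj (c t)) k j (Complex.continuous_conj.comp hc)).congr
      fun t z => by simp; ring

lemma reparam {f : ℝ → ℂ → ℂ} (hf : IsPolyFamily f) {s : ℝ → ℝ} (hs : Continuous s) :
    IsPolyFamily fun t z => f (s t) z := by
  induction hf with
  | add _ _ h1 h2 => exact h1.add h2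
  | monomial c j k hc => exact monomial (fun t => c (s t)) j k (hc.comp hs)

lemma comp {f g : ℝ → ℂ → ℂ} (hf : IsPolyFamily f) (hg : IsPolyFamily g) :
    IsPolyFamily fun t z => f t (g t z) := by
  induction hf with
  | add _ _ h1 h2 => exact h1.add h2
  | monomial c j k hc => exact ((hg.pow j).coeff_mul hc).mul (hg.conj'.pow k)

lemma isPlanarPoly {f : ℝ → ℂ → ℂ} (hf : IsPolyFamily f) (t : ℝ) : IsPlanarPoly (f t) :=
  hf.reparam (continuous_const (y := t))

lemma continuous_time {f : ℝ → ℂ → ℂ} (hf : IsPolyFamily f) (z : ℂ) :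
    Continuous fun t => f t z := by
  induction hf with
  | add _ _ h1 h2 => exact h1.add h2
  | monomial c j k hc => fun_prop

/-- Time enters only through the coefficients, so integration acts on them alone. This keeps Picard
iterates polynomial in `z` and `z̄`. -/
lemma integral {f : ℝ → ℂ → ℂ} (hf : IsPolyFamily f) :
    IsPolyFamily fun t z => ∫ s in (0 : ℝ)..t, f s z := by
  induction hf with
  | @add f g hf hg h1 h2 =>
    refine (h1.add h2).congr fun t z => ?_
    rw [intervalIntegral.integral_add]
    · exact (hf.continuous_time z).intervalIntegrable _ _
    · exact (hg.continuous_time z).intervalIntegrable _ _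
  | monomial c j k hc =>
    refine (monomial (fun t => ∫ s in (0 : ℝ)..t, c s) j k
      (intervalIntegral.continuous_primitive (fun a b => hc.intervalIntegrable a b) 0)).congr
      fun t z => ?_
    simp_rw [mul_assoc]
    rw [intervalIntegral.integral_mul_const]

lemma hasDerivAt_integral {f : ℝ → ℂ → ℂ} (hf : IsPolyFamily f) (z : ℂ) (t : ℝ) :
    HasDerivAt (fun t => ∫ s in (0 : ℝ)..t, f s z) (f t z) t :=
  intervalIntegral.integral_hasDerivAt_right ((hf.continuous_time z).intervalIntegrable 0 t)
    (hf.continuous_time z).stronglyMeasurable.stronglyMeasurableAtFilter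
    (hf.continuous_time z).continuousAt

lemma sum {ι : Type*} {s : Finset ι} {f : ι → ℝ → ℂ → ℂ} (hf : ∀ i ∈ s, IsPolyFamily (f i)) :
    IsPolyFamily fun t z => ∑ i ∈ s, f i t z := by
  classical
  induction s using Finset.induction_on with
  | empty => exact (coeff (continuous_const (y := (0 : ℂ)))).congr (by simp)
  | insert a s ha ih =>
    refine ((hf a (by simp)).add (ih fun i hi => hf i (by simp [hi]))).congr fun t z => ?_
    rw [Finset.sum_insert ha]

lemma contDiff {f : ℝ → ℂ → ℂ} (hf : IsPolyFamily f) (t : ℝ) {n : WithTop ℕ∞} :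
    ContDiff ℝ n (f t) := by
  induction hf with
  | add _ _ h1 h2 => exact h1.add h2
  | monomial c j k hc =>
    have : ContDiff ℝ n fun z : ℂ => conj z := Complex.conjCLE.contDiff
    fun_prop

end IsPolyFamily

/-! ### Homogeneous polynomials and order of vanishing -/

lemma isPlanarPoly_homPoly (m : ℕ) (c : ℕ × ℕ → ℂ) : IsPlanarPoly (homPoly m c) :=
  IsPolyFamily.sum (f := fun p _ z => c p * z ^ p.1 * conj z ^ p.2)
    fun p _ => .monomial (fun _ => c p) _ _ continuous_const

lemma homPoly_add (m : ℕ) (c d : ℕ × ℕ → ℂ) (z : ℂ) :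
    homPoly m (c + d) z = homPoly m c z + homPoly m d z := by
  simp [homPoly, add_mul, Finset.sum_add_distrib]

lemma homPoly_sub (m : ℕ) (c d : ℕ × ℕ → ℂ) (z : ℂ) :
    homPoly m (c - d) z = homPoly m c z - homPoly m d z := by
  simp [homPoly, sub_mul, Finset.sum_sub_distrib]

lemma homPoly_smul (m : ℕ) (a : ℂ) (c : ℕ × ℕ → ℂ) (z : ℂ) :
    homPoly m (a • c) z = a * homPoly m c z := by
  simp [homPoly, Finset.mul_sum, mul_assoc]

lemma homPoly_congr {m : ℕ} {c d : ℕ × ℕ → ℂ}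
    (h : ∀ p ∈ Finset.HasAntidiagonal.antidiagonal m, c p = d p) (z : ℂ) :
    homPoly m c z = homPoly m d z :=
  Finset.sum_congr rfl fun p hp => by rw [h p hp]

lemma norm_homPoly_le (m : ℕ) (c : ℕ × ℕ → ℂ) (z : ℂ) :
    ‖homPoly m c z‖ ≤ (∑ p ∈ Finset.HasAntidiagonal.antidiagonal m, ‖c p‖) * ‖z‖ ^ m := by
  rw [Finset.sum_mul]
  refine (norm_sum_le _ _).trans (Finset.sum_le_sum fun p hp => ?_)
  rw [← Finset.HasAntidiagonal.mem_antidiagonal.1 hp]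
  simp [pow_add, mul_assoc]

lemma homPoly_isBigO (m : ℕ) (c : ℕ × ℕ → ℂ) :
    homPoly m c =O[𝓝 0] fun z => ‖z‖ ^ m :=
  IsBigO.of_bound _ (Eventually.of_forall fun z => by
    simpa using norm_homPoly_le m c z)

lemma homPoly_ofReal_mul (m : ℕ) (c : ℕ × ℕ → ℂ) (r : ℝ) (z : ℂ) :
    homPoly m c (r * z) = (r : ℂ) ^ m * homPoly m c z := by
  rw [homPoly, homPoly, Finset.mul_sum]
  refine Finset.sum_congr rfl fun p hp => ?_
  rw [← Finset.HasAntidiagonal.mem_antidiagonal.1 hp]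
  simp; ring

/-- `|z|^m` is `O(|z|^k)` near `0` when `k ≤ m`. -/
lemma isBigO_norm_pow_of_le {k m : ℕ} (h : k ≤ m) :
    (fun z : ℂ => ‖z‖ ^ m) =O[𝓝 0] fun z => ‖z‖ ^ k := by
  refine IsBigO.of_bound 1 ?_
  filter_upwards [Metric.ball_mem_nhds (0 : ℂ) one_pos] with z hz
  have hz : ‖z‖ < 1 := by simpa using hz
  simpa using pow_le_pow_of_le_one (norm_nonneg z) hz.le h

/-- On the unit circle, `u^m u^j ū^k = (u^2)^j` when `j + k = m`. With `u = exp(iθ/2)`, the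
one-variable polynomial with coefficients `c (j, m - j)` thus vanishes at every `exp(iθ)`, `0 < θ <
1`, which is an infinite set of roots. -/
lemma eq_zero_of_forall_homPoly_eq_zero {m : ℕ} {c : ℕ × ℕ → ℂ} (h : ∀ z, homPoly m c z = 0) :
    ∀ p ∈ Finset.HasAntidiagonal.antidiagonal m, c p = 0 := by
  have key : (∑ p ∈ Finset.HasAntidiagonal.antidiagonal m,
      Polynomial.monomial p.1 (c p) : Polynomial ℂ) = 0 := by
    refine Polynomial.eq_zero_of_infinite_isRoot _ (Set.Infinite.mono (s := Set.range
      fun θ : Ioo (0 : ℝ) 1 => Complex.exp (θ * Complex.I)) ?_ ?_)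
    · rintro _ ⟨θ, rfl⟩
      set u := Complex.exp ((θ : ℝ) / 2 * Complex.I)
      have hu : conj u * u = 1 := by
        rw [← Complex.normSq_eq_conj_mul_self, Complex.normSq_eq_norm_sq,
          show u = Complex.exp (((θ : ℝ) / 2 : ℝ) * Complex.I) by simp [u],
          Complex.norm_exp_ofReal_mul_I]
        simp
      have hw : Complex.exp ((θ : ℝ) * Complex.I) = u ^ 2 := by
        rw [← Complex.exp_nat_mul]; congr 1; push_cast; ring
      have := congrArg (u ^ m * ·) (h u)
      simp only [mul_zero, homPoly, Finset.mul_sum] at this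
      simp only [Set.mem_ofPred_eq, Polynomial.IsRoot, Polynomial.eval_finsetSum, hw]
      rw [← this]
      refine Finset.sum_congr rfl fun p hp => ?_
      rw [Polynomial.eval_monomial, ← Finset.HasAntidiagonal.mem_antidiagonal.1 hp]
      calc c p * (u ^ 2) ^ p.1 = c p * u ^ (2 * p.1) * (conj u * u) ^ p.2 := by
            rw [hu]; ring
        _ = _ := by ring
    · have : Infinite (Ioo (0 : ℝ) 1) := (Set.Ioo_infinite one_pos).to_subtype
      refine Set.infinite_range_of_injective fun a b hab => Subtype.ext ?_
      have hπ := Real.pi_gt_three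
      have := Complex.exp_inj_of_neg_pi_lt_of_le_pi (x := (a : ℝ) * Complex.I)
        (y := (b : ℝ) * Complex.I) (by simp; linarith [a.2.1]) (by simp; linarith [a.2.2])
        (by simp; linarith [b.2.1]) (by simp; linarith [b.2.2]) hab
      simpa using this
  intro p hp
  have h1 := congrArg (fun q => Polynomial.coeff q p.1) key
  simp only [Polynomial.finsetSum_coeff, Polynomial.coeff_zero, Polynomial.coeff_monomial] at h1
  rw [Finset.sum_eq_single_of_mem p hp] at h1
  · simpa using h1
  · intro q hq hqp
    refine if_neg fun h => hqp ?_
    rw [Finset.HasAntidiagonal.mem_antidiagonal] at hp hq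
    ext <;> omega

/-- Along the ray `r z` the left side scales as `r^m` and the bound as `r^(m+1)`; divide by `r^m`
and let `r` tend to `0`. -/
lemma homPoly_eq_zero_of_isBigO {m : ℕ} {c : ℕ × ℕ → ℂ}
    (h : homPoly m c =O[𝓝 0] fun z => ‖z‖ ^ (m + 1)) (z : ℂ) : homPoly m c z = 0 := by
  obtain ⟨C, hC⟩ := h.bound
  have ht : Tendsto (fun r : ℝ => (r : ℂ) * z) (𝓝[>] 0) (𝓝 0) := by
    have : Continuous fun r : ℝ => (r : ℂ) * z := by fun_prop
    simpa using (this.tendsto 0).mono_left nhdsWithin_le_nhds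
  have h2 : ∀ᶠ r : ℝ in 𝓝[>] 0, ‖homPoly m c z‖ ≤ r * (C * ‖z‖ ^ (m + 1)) := by
    filter_upwards [ht.eventually hC, self_mem_nhdsWithin] with r hr hr0
    have hr0 : 0 < r := hr0
    rw [homPoly_ofReal_mul] at hr
    simp only [norm_mul, norm_pow, Complex.norm_real, Real.norm_eq_abs,
      abs_of_pos hr0, abs_norm] at hr
    have : r ^ m * ‖homPoly m c z‖ ≤ r ^ m * (r * (C * ‖z‖ ^ (m + 1))) := by
      refine hr.trans (le_of_eq ?_); ring
    exact le_of_mul_le_mul_left this (by positivity)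
  have h3 : Tendsto (fun r : ℝ => r * (C * ‖z‖ ^ (m + 1))) (𝓝[>] 0) (𝓝 0) := by
    have : Continuous fun r : ℝ => r * (C * ‖z‖ ^ (m + 1)) := by fun_prop
    simpa using (this.tendsto 0).mono_left nhdsWithin_le_nhds
  simpa using ge_of_tendsto h3 h2

lemma coeff_eq_zero_of_isBigO {m : ℕ} {c : ℕ × ℕ → ℂ}
    (h : homPoly m c =O[𝓝 0] fun z => ‖z‖ ^ (m + 1)) :
    ∀ p ∈ Finset.HasAntidiagonal.antidiagonal m, c p = 0 :=
  eq_zero_of_forall_homPoly_eq_zero (homPoly_eq_zero_of_isBigO h)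

lemma homPoly_single (j k : ℕ) (a z : ℂ) :
    homPoly (j + k) (Pi.single (j, k) a) z = a * z ^ j * conj z ^ k := by
  rw [homPoly, Finset.sum_eq_single_of_mem (j, k) (by simp)]
  · simp
  · intro q _ hq
    simp [Pi.single_eq_of_ne hq]

/-- A polynomial is the sum of its homogeneous parts of degree `< m`, up to order `m`. -/
lemma IsPlanarPoly.exists_sum_homPoly {f : ℂ → ℂ} (hf : IsPlanarPoly f) (m : ℕ) :
    ∃ c : ℕ × ℕ → ℂ,
      (fun z => f z - ∑ k ∈ Finset.range m, homPoly k c z) =O[𝓝 0] fun z => ‖z‖ ^ m := by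
  -- Induction needs an arbitrary family, because the summands of a constant family need not be
  -- constant in time. Time `0` is an arbitrary choice.
  have key : ∀ F : ℝ → ℂ → ℂ, IsPolyFamily F → ∃ c : ℕ × ℕ → ℂ,
      (fun z => F 0 z - ∑ k ∈ Finset.range m, homPoly k c z) =O[𝓝 0] fun z => ‖z‖ ^ m := by
    intro F hF
    induction hF with
    | add _ _ h1 h2 =>
      obtain ⟨c, hc⟩ := h1
      obtain ⟨d, hd⟩ := h2
      refine ⟨c + d, (hc.add hd).congr_left fun z => ?_⟩
      simp only [homPoly_add, Finset.sum_add_distrib]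
      ring
    | monomial a j k ha =>
      have hp := homPoly_single j k (a 0)
      have hp0 : ∀ i ≠ j + k, ∀ z, homPoly i (Pi.single (j, k) (a 0)) z = 0 := by
        intro i hi z
        refine Finset.sum_eq_zero fun q hq => ?_
        rw [Pi.single_eq_of_ne]
        · simp
        · rintro rfl
          exact hi (Finset.HasAntidiagonal.mem_antidiagonal.1 hq).symm
      refine ⟨Pi.single (j, k) (a 0), ?_⟩
      by_cases hm : j + k < m
      · refine (isBigO_zero _ _).congr_left fun z => ?_
        rw [Finset.sum_eq_single_of_mem (j + k) (by simpa using hm) fun i _ hi => hp0 i hi z, hp]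
        simp
      · refine ((homPoly_isBigO (j + k) (Pi.single (j, k) (a 0))).trans
          (isBigO_norm_pow_of_le (not_lt.1 hm))).congr_left fun z => ?_
        rw [Finset.sum_eq_zero, hp, sub_zero]
        intro i hi
        exact hp0 i (by have := Finset.mem_range.1 hi; omega) z
  exact key _ hf

/-- A polynomial vanishing to order `m` is homogeneous of degree `m` up to order `m + 1`. -/
lemma IsPlanarPoly.exists_homPoly {f : ℂ → ℂ} (hf : IsPlanarPoly f) {m : ℕ}
    (h : f =O[𝓝 0] fun z => ‖z‖ ^ m) :
    ∃ c : ℕ × ℕ → ℂ, (fun z => f z - homPoly m c z) =O[𝓝 0] fun z => ‖z‖ ^ (m + 1) := by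
  obtain ⟨c, hc⟩ := hf.exists_sum_homPoly (m + 1)
  -- Once the parts of degree below `k` are gone, the part of degree `k` is `O(|z|^(k+1))` and hence
  -- zero.
  have low : ∀ k < m, ∀ z, homPoly k c z = 0 := by
    intro k
    induction k using Nat.strong_induction_on with
    | _ k ih =>
      intro hk
      refine homPoly_eq_zero_of_isBigO ?_
      have h1 : f =O[𝓝 0] fun z => ‖z‖ ^ (k + 1) := h.trans (isBigO_norm_pow_of_le hk)
      have h2 := hc.trans (isBigO_norm_pow_of_le (show k + 1 ≤ m + 1 by omega))
      have h3 : (fun z => ∑ i ∈ Finset.Ico (k + 1) (m + 1), homPoly i c z) =O[𝓝 0]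
          fun z => ‖z‖ ^ (k + 1) := by
        refine IsBigO.fun_sum fun i hi => (homPoly_isBigO i c).trans (isBigO_norm_pow_of_le ?_)
        exact (Finset.mem_Ico.1 hi).1
      refine ((h1.sub h2).sub h3).congr_left fun z => ?_
      rw [← Finset.sum_range_add_sum_Ico _ (show k + 1 ≤ m + 1 by omega), Finset.sum_range_succ,
        Finset.sum_eq_zero fun i hi => ih i (Finset.mem_range.1 hi)
          ((Finset.mem_range.1 hi).trans hk) z]
      ring
  refine ⟨c, hc.congr_left fun z => ?_⟩
  rw [Finset.sum_range_succ, Finset.sum_eq_zero fun i hi => low i (Finset.mem_range.1 hi) z,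
    zero_add]

/-! ### Quadratic remainders and Taylor's formula -/

/-- `R` vanishes at `0` and its Lipschitz constant on small balls is of the order of the radius. -/
structure IsQuadLipschitz (R : ℂ → ℂ) : Prop where
  map_zero : R 0 = 0
  isBigO_sub : (fun p : ℂ × ℂ => R p.1 - R p.2) =O[𝓝 0]
    fun p => (‖p.1‖ + ‖p.2‖) * ‖p.1 - p.2‖

lemma eq_zero_of_isBigO_norm_pow {f : ℂ → ℂ} {m : ℕ} (hm : m ≠ 0)
    (h : f =O[𝓝 0] fun z => ‖z‖ ^ m) : f 0 = 0 := by
  have := h.eq_zero_imp.self_of_nhds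
  exact this (by simp [hm])

lemma IsQuadLipschitz.isBigO {R : ℂ → ℂ} (hR : IsQuadLipschitz R) :
    R =O[𝓝 0] fun z => ‖z‖ ^ 2 := by
  have ht : Tendsto (fun z : ℂ => (z, (0 : ℂ))) (𝓝 0) (𝓝 0) := by
    have : Continuous fun z : ℂ => (z, (0 : ℂ)) := by fun_prop
    exact this.tendsto' 0 0 rfl
  refine (hR.isBigO_sub.comp_tendsto ht).congr (fun z => ?_) fun z => ?_
  · simp [hR.map_zero]
  · simp [sq]

lemma hasFDerivAt_zero_of_isBigO {f : ℂ → ℂ} (hO : f =O[𝓝 0] fun z => ‖z‖ ^ 2) :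
    HasFDerivAt f (0 : ℂ →L[ℝ] ℂ) 0 :=
  IsBigO.hasFDerivAt (n := 2) (by simpa using hO) (by norm_num)

/-- The derivative is Lipschitz near `0` and vanishes there, so it is bounded by a multiple of
`‖x‖`. The mean value inequality on the ball of radius `max ‖p.1‖ ‖p.2‖` gives the estimate. -/
lemma isQuadLipschitz_of_contDiffAt {R : ℂ → ℂ} (h : ContDiffAt ℝ 2 R 0)
    (h0 : R 0 = 0) (hd0 : fderiv ℝ R 0 = 0) : IsQuadLipschitz R := by
  refine ⟨h0, ?_⟩
  obtain ⟨K, s, hs, hK⟩ :=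
    (h.fderiv_right (m := 1) (by norm_num)).exists_lipschitzOnWith
  obtain ⟨r, hr, hball⟩ := Metric.mem_nhds_iff.1
    (inter_mem hs ((h.eventually (by simp)).mono fun z hz => hz.differentiableAt (by simp)))
  refine IsBigO.of_bound K ?_
  filter_upwards [Metric.ball_mem_nhds (0 : ℂ × ℂ) hr] with p hp
  rw [mem_ball_zero_iff, Prod.norm_def, max_lt_iff] at hp
  have key := (convex_closedBall (0 : ℂ) (max ‖p.1‖ ‖p.2‖)).norm_image_sub_le_of_norm_fderiv_le
    (𝕜 := ℝ) (f := R) (C := K * (‖p.1‖ + ‖p.2‖)) (x := p.2) (y := p.1) ?_ ?_ ?_ ?_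
  · rw [norm_mul, norm_norm, Real.norm_of_nonneg (by positivity), ← mul_assoc]
    exact key
  · intro x hx
    rw [mem_closedBall_zero_iff] at hx
    exact (hball (mem_ball_zero_iff.2 (hx.trans_lt (max_lt hp.1 hp.2)))).2
  · intro x hx
    rw [mem_closedBall_zero_iff] at hx
    have h1 := hK.norm_sub_le (hball (mem_ball_zero_iff.2 (hx.trans_lt (max_lt hp.1 hp.2)))).1
      (mem_of_mem_nhds hs)
    rw [hd0, sub_zero, sub_zero] at h1
    refine h1.trans ?_
    gcongr
    exact hx.trans (max_le_add_of_nonneg (norm_nonneg _) (norm_nonneg _))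
  · simp
  · simp

lemma realLinear_apply (T : ℂ →L[ℝ] ℂ) (z : ℂ) :
    T z = z.re * T 1 + z.im * T Complex.I := by
  have hz : z = z.re • (1 : ℂ) + z.im • Complex.I := by simp [Complex.re_add_im]
  calc T z = T (z.re • (1 : ℂ) + z.im • Complex.I) := by rw [← hz]
    _ = _ := by rw [map_add, map_smul, map_smul, Complex.real_smul, Complex.real_smul]

/-- Taylor's formula: a `C^m` map agrees near `0` with a polynomial up to order `m`. -/
lemma ContDiffAt.exists_isPlanarPoly {m : ℕ} {f : ℂ → ℂ} (hf : ContDiffAt ℝ m f 0) :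
    ∃ p, IsPlanarPoly p ∧ (fun z => f z - p z) =O[𝓝 0] fun z => ‖z‖ ^ m := by
  induction m generalizing f with
  | zero =>
    refine ⟨fun _ => 0, .coeff continuous_const, ?_⟩
    simpa using hf.continuousAt.isBigO_one ℝ
  | succ m ih =>
    have hfd : ContDiffAt ℝ m (fderiv ℝ f) 0 := hf.fderiv_right (by norm_cast)
    obtain ⟨p₁, hp₁, h₁⟩ := ih (hfd.clm_apply (contDiffAt_const (c := (1 : ℂ))))
    obtain ⟨p₂, hp₂, h₂⟩ := ih (hfd.clm_apply (contDiffAt_const (c := Complex.I)))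
    have scale : ∀ {p}, IsPlanarPoly p → IsPolyFamily fun s z => p ((s : ℂ) * z) := fun hp =>
      hp.comp (IsPolyFamily.var.coeff_mul Complex.continuous_ofReal)
    -- `Q t z` integrates the Taylor polynomials of the two partial derivatives along the segment
    -- from `0` to `t z`. The derivative of `f (t z) - Q t z` in `t` is `O(|z|^(m+1))`, since the
    -- factors `z.re` and `z.im` supply one extra order.
    set Q : ℝ → ℂ → ℂ := fun t z => f 0 + ((z.re : ℂ) * (∫ s in (0 : ℝ)..t, p₁ (s * z)) +
      (z.im : ℂ) * ∫ s in (0 : ℝ)..t, p₂ (s * z)) with hQ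
    refine ⟨Q 1, ?_, ?_⟩
    · have hre : IsPolyFamily fun _ z => (z.re : ℂ) :=
        ((IsPolyFamily.var.add IsPolyFamily.var.conj').coeff_mul
          (continuous_const (y := (1 / 2 : ℂ)))).congr fun _ z => by
            rw [Complex.re_eq_add_conj]; ring
      have him : IsPolyFamily fun _ z => (z.im : ℂ) :=
        ((IsPolyFamily.var.add (IsPolyFamily.var.conj'.coeff_mul
          (continuous_const (y := (-1 : ℂ))))).coeff_mul
          (continuous_const (y := (1 / (2 * Complex.I) : ℂ)))).congr fun _ z => by
            rw [Complex.im_eq_sub_conj]; ring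
      exact ((IsPolyFamily.coeff (continuous_const (y := f 0))).add
        ((hre.mul (scale hp₁).integral).add (him.mul (scale hp₂).integral))).isPlanarPoly 1
    · obtain ⟨C₁, hC₁, h₁⟩ := h₁.exists_nonneg
      obtain ⟨C₂, hC₂, h₂⟩ := h₂.exists_nonneg
      have hdiff : ∀ᶠ z in 𝓝 (0 : ℂ), DifferentiableAt ℝ f z :=
        (hf.of_le (m := 1) (by norm_cast; omega)).eventually (by simp) |>.mono
          fun z hz => hz.differentiableAt (by simp)
      obtain ⟨r, hr, hball⟩ := Metric.eventually_nhds_iff_ball.1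
        (h₁.bound.and (h₂.bound.and hdiff))
      refine IsBigO.of_bound (C₁ + C₂) ?_
      filter_upwards [Metric.ball_mem_nhds (0 : ℂ) hr] with z hz
      have hmem : ∀ t ∈ Icc (0 : ℝ) 1, (t : ℂ) * z ∈ Metric.ball (0 : ℂ) r ∧
          ‖(t : ℂ) * z‖ ≤ ‖z‖ := by
        intro t ht
        have : ‖(t : ℂ) * z‖ ≤ ‖z‖ := by
          rw [norm_mul, Complex.norm_real, Real.norm_of_nonneg ht.1]
          exact mul_le_of_le_one_left (norm_nonneg _) ht.2
        exact ⟨mem_ball_zero_iff.2 (this.trans_lt (mem_ball_zero_iff.1 hz)), this⟩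
      have hderiv : ∀ t ∈ Icc (0 : ℝ) 1, HasDerivWithinAt (fun t : ℝ => f (t * z) - Q t z)
          (z.re * (fderiv ℝ f (t * z) 1 - p₁ (t * z)) +
            z.im * (fderiv ℝ f (t * z) Complex.I - p₂ (t * z))) (Icc 0 1) t := by
        intro t ht
        have hlin : HasDerivAt (fun t : ℝ => (t : ℂ) * z) z t := by
          simpa using (Complex.ofRealCLM.hasDerivAt (x := t)).mul_const z
        have hf1 := (hball _ (hmem t ht).1).2.2.hasFDerivAt.comp_hasDerivAt t hlin
        have hi₁ := (scale hp₁).hasDerivAt_integral z t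
        have hi₂ := (scale hp₂).hasDerivAt_integral z t
        have hz : fderiv ℝ f (t * z) z =
            z.re * fderiv ℝ f (t * z) 1 + z.im * fderiv ℝ f (t * z) Complex.I :=
          realLinear_apply _ z
        refine (hf1.sub (((hi₁.const_mul (z.re : ℂ)).add
          (hi₂.const_mul (z.im : ℂ))).const_add (f 0))).hasDerivWithinAt.congr_deriv ?_
        rw [hz]
        ring
      have hb : ∀ t ∈ Ico (0 : ℝ) 1, ‖(z.re * (fderiv ℝ f (t * z) 1 - p₁ (t * z)) +
            z.im * (fderiv ℝ f (t * z) Complex.I - p₂ (t * z)) : ℂ)‖ ≤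
            (C₁ + C₂) * ‖z‖ ^ (m + 1) := by
        intro t ht
        obtain ⟨hm1, hm2⟩ := hmem t ⟨ht.1, ht.2.le⟩
        obtain ⟨b₁, b₂, -⟩ := hball _ hm1
        rw [norm_pow, norm_norm] at b₁ b₂
        have hpow : ‖(t : ℂ) * z‖ ^ m ≤ ‖z‖ ^ m := pow_le_pow_left₀ (norm_nonneg _) hm2 m
        calc _ ≤ ‖z‖ * (C₁ * ‖z‖ ^ m) + ‖z‖ * (C₂ * ‖z‖ ^ m) := by
              refine (norm_add_le _ _).trans ?_
              rw [norm_mul, norm_mul, Complex.norm_real, Complex.norm_real]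
              gcongr
              · exact Complex.abs_re_le_norm z
              · exact b₁.trans (by gcongr)
              · exact Complex.abs_im_le_norm z
              · exact b₂.trans (by gcongr)
          _ = _ := by ring
      have := norm_image_sub_le_of_norm_deriv_le_segment_01' hderiv hb
      simpa [hQ] using this

/-! ### Estimates uniform over times in the unit interval -/

/-- Points near the origin, uniformly over the times in `[0, 1]`. -/
noncomputable def unitTimes : Filter (ℂ × ℝ) := 𝓝 0 ×ˢ 𝓟 (Icc 0 1)

/-- `f' t z` is the time derivative of `f t z` for `t ∈ [0, 1]` and `z` near `0`. -/
def HasTimeDeriv (f f' : ℝ → ℂ → ℂ) : Prop :=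
  ∀ᶠ z in 𝓝 (0 : ℂ), ∀ t ∈ Icc (0 : ℝ) 1,
    HasDerivWithinAt (fun t => f t z) (f' t z) (Icc 0 1) t

/-- `φ` solves `ż = X(z)` for times in `[0, 1]` and initial points near `0`. -/
structure IsUnitFlow (X : ℂ → ℂ) (φ : ℝ → ℂ → ℂ) : Prop where
  map_zero : ∀ᶠ z in 𝓝 (0 : ℂ), φ 0 z = z
  hasTimeDeriv : HasTimeDeriv φ fun t z => X (φ t z)

lemma eventually_unitTimes {P : ℂ × ℝ → Prop} :
    (∀ᶠ p in unitTimes, P p) ↔ ∀ᶠ z in 𝓝 (0 : ℂ), ∀ t ∈ Icc (0 : ℝ) 1, P (z, t) :=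
  eventually_prod_principal_iff

lemma tendsto_fst_unitTimes : Tendsto Prod.fst unitTimes (𝓝 (0 : ℂ)) := tendsto_fst

lemma isBigO_at_one {f : ℝ → ℂ → ℂ} {m : ℕ}
    (h : (fun p : ℂ × ℝ => f p.2 p.1) =O[unitTimes] fun p => ‖p.1‖ ^ m) :
    f 1 =O[𝓝 0] fun z => ‖z‖ ^ m := by
  have ht : Tendsto (fun z : ℂ => (z, (1 : ℝ))) (𝓝 0) unitTimes :=
    tendsto_id.prodMk (tendsto_principal.2 (Eventually.of_forall fun _ => by simp))
  exact h.comp_tendsto ht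

lemma isBigO_one_of_continuous {c : ℝ → ℂ} (hc : Continuous c) :
    (fun p : ℂ × ℝ => c p.2) =O[unitTimes] fun _ => (1 : ℝ) := by
  obtain ⟨C, hC⟩ := isCompact_Icc.exists_bound_of_continuousOn (s := Icc (0 : ℝ) 1)
    hc.continuousOn
  refine IsBigO.of_bound C ?_
  rw [eventually_unitTimes]
  exact Eventually.of_forall fun z t ht => by simpa using hC t ht

lemma isBigO_coeff_mul {c : ℝ → ℂ} (hc : Continuous c) {f : ℂ × ℝ → ℂ} {g : ℂ × ℝ → ℝ}
    (h : f =O[unitTimes] g) : (fun p => c p.2 * f p) =O[unitTimes] g := by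
  simpa using (isBigO_one_of_continuous hc).mul h

lemma isBigO_unitTimes_pow_of_le {k m : ℕ} (h : k ≤ m) :
    (fun p : ℂ × ℝ => ‖p.1‖ ^ m) =O[unitTimes] fun p => ‖p.1‖ ^ k :=
  (isBigO_norm_pow_of_le h).comp_tendsto tendsto_fst_unitTimes

lemma isBigO_comp {R : ℂ → ℂ} {m : ℕ} (hR : R =O[𝓝 0] fun z => ‖z‖ ^ m) {φ : ℝ → ℂ → ℂ}
    (hφ : (fun p : ℂ × ℝ => φ p.2 p.1) =O[unitTimes] fun p => ‖p.1‖ ^ 1) :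
    (fun p : ℂ × ℝ => R (φ p.2 p.1)) =O[unitTimes] fun p => ‖p.1‖ ^ m := by
  have ht : Tendsto (fun p : ℂ × ℝ => φ p.2 p.1) unitTimes (𝓝 0) := by
    refine hφ.trans_tendsto ?_
    simpa [Function.comp_def] using (tendsto_norm_zero (E := ℂ)).comp tendsto_fst_unitTimes
  refine (hR.comp_tendsto ht).trans ?_
  simpa [Function.comp_def] using hφ.norm_left.pow m

namespace HasTimeDeriv

lemma sub {f f' g g' : ℝ → ℂ → ℂ} (hf : HasTimeDeriv f f') (hg : HasTimeDeriv g g') :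
    HasTimeDeriv (fun t z => f t z - g t z) fun t z => f' t z - g' t z := by
  filter_upwards [hf, hg] with z h1 h2 t ht using (h1 t ht).sub (h2 t ht)

lemma integral {f : ℝ → ℂ → ℂ} (hf : IsPolyFamily f) :
    HasTimeDeriv (fun t z => ∫ s in (0 : ℝ)..t, f s z) f :=
  Eventually.of_forall fun z t _ => (hf.hasDerivAt_integral z t).hasDerivWithinAt

/-- Grönwall's inequality, uniformly over the initial points near `0`. -/
lemma isBigO_of_deriv {f f' : ℝ → ℂ → ℂ} {m : ℕ} (hf : HasTimeDeriv f f')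
    (h0 : ∀ᶠ z in 𝓝 0, f 0 z = 0)
    (hO : (fun p : ℂ × ℝ => f' p.2 p.1) =O[unitTimes] fun p => ‖f p.2 p.1‖ + ‖p.1‖ ^ m) :
    (fun p : ℂ × ℝ => f p.2 p.1) =O[unitTimes] fun p => ‖p.1‖ ^ m := by
  obtain ⟨C, hC, hb⟩ := hO.exists_pos
  have hb := hb.bound
  rw [eventually_unitTimes] at hb
  refine IsBigO.of_bound (Real.exp C) ?_
  rw [eventually_unitTimes]
  filter_upwards [hf, h0, hb] with z hz hz0 hzb t ht
  have key := norm_le_gronwallBound_of_norm_deriv_right_le (f := fun t => f t z)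
    (f' := fun t => f' t z) (δ := 0) (K := C) (ε := C * ‖z‖ ^ m) (a := 0) (b := 1)
    (fun t ht => (hz t ht).continuousWithinAt)
    (fun t ht => (hz t ⟨ht.1, ht.2.le⟩).mono_of_mem_nhdsWithin (Icc_mem_nhdsGE_of_mem ht))
    (by simp [hz0])
    (fun t ht => by
      have := hzb t ⟨ht.1, ht.2.le⟩
      rwa [Real.norm_of_nonneg (by positivity), mul_add] at this) t ht
  -- With rate `C` and forcing `C ‖z‖^m` the Grönwall bound is `‖z‖^m (exp(C t) - 1)`.
  rw [gronwallBound_of_K_ne_0 hC.ne'] at key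
  simp only [zero_mul, zero_add, sub_zero, mul_div_cancel_left₀ _ hC.ne'] at key
  rw [norm_pow, norm_norm, mul_comm]
  refine key.trans ?_
  gcongr
  have : Real.exp (C * t) ≤ Real.exp C := by
    gcongr
    exact mul_le_of_le_one_right hC.le ht.2
  linarith

lemma isBigO_of_deriv' {f f' : ℝ → ℂ → ℂ} {m : ℕ} (hf : HasTimeDeriv f f')
    (h0 : ∀ᶠ z in 𝓝 0, f 0 z = 0)
    (hO : (fun p : ℂ × ℝ => f' p.2 p.1) =O[unitTimes] fun p => ‖p.1‖ ^ m) :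
    (fun p : ℂ × ℝ => f p.2 p.1) =O[unitTimes] fun p => ‖p.1‖ ^ m := by
  refine hf.isBigO_of_deriv h0 (hO.trans (IsBigO.of_bound 1 (Eventually.of_forall fun p => ?_)))
  rw [Real.norm_of_nonneg (by positivity), Real.norm_of_nonneg (by positivity), one_mul]
  exact le_add_of_nonneg_left (norm_nonneg _)

end HasTimeDeriv

/-- A flow near a zero of the field stays within a multiple of the initial distance. -/
lemma IsUnitFlow.isBigO {X : ℂ → ℂ} {φ : ℝ → ℂ → ℂ} (h : IsUnitFlow X φ)
    (hX : X =O[𝓝 0] fun z => ‖z‖) :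
    (fun p : ℂ × ℝ => φ p.2 p.1) =O[unitTimes] fun p => ‖p.1‖ ^ 1 := by
  obtain ⟨K, hK, hb⟩ := hX.exists_nonneg
  obtain ⟨r, hr, hball⟩ := Metric.eventually_nhds_iff_ball.1 hb.bound
  set E := Real.exp (K + 1)
  have hE : 0 < E := Real.exp_pos _
  -- The bound on `X` holds only in the ball of radius `r`, so the orbit is confined by the barrier
  -- `ρ exp((K+1)t)`. The rate `K + 1` exceeds `K`, and `ρ` is positive, so that the barrier grows
  -- strictly faster than the orbit wherever they touch.
  have trap : ∀ z, φ 0 z = z → (∀ t ∈ Icc (0 : ℝ) 1,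
      HasDerivWithinAt (fun t => φ t z) (X (φ t z)) (Icc 0 1) t) →
      ∀ ρ, 0 < ρ → ‖z‖ ≤ ρ → ρ * E < r → ∀ t ∈ Icc (0 : ℝ) 1, ‖φ t z‖ ≤ ρ * E := by
    intro z hz0 hz ρ hρ hzρ hρr t ht
    have hexp : ∀ t ∈ Icc (0 : ℝ) 1, ρ * Real.exp ((K + 1) * t) ≤ ρ * E := fun t ht => by
      have : (K + 1) * t ≤ K + 1 := mul_le_of_le_one_right (by positivity) ht.2
      gcongr
      exact Real.exp_le_exp.2 this
    refine le_trans ?_ (hexp t ht)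
    refine image_norm_le_of_norm_deriv_right_lt_deriv_boundary (f := fun t => φ t z)
      (f' := fun t => X (φ t z)) (a := 0) (b := 1)
      (B := fun t => ρ * Real.exp ((K + 1) * t))
      (B' := fun t => (K + 1) * (ρ * Real.exp ((K + 1) * t)))
      (fun t ht => (hz t ht).continuousWithinAt)
      (fun t ht => (hz t ⟨ht.1, ht.2.le⟩).mono_of_mem_nhdsWithin (Icc_mem_nhdsGE_of_mem ht))
      ?_ ?_ ?_ ht
    · simpa [hz0] using hzρ
    · intro t
      exact ((((hasDerivAt_id t).const_mul (K + 1)).exp).const_mul ρ).congr_deriv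
        (by simp only [id, mul_one]; ring)
    · intro t ht hB
      have hpos : 0 < ρ * Real.exp ((K + 1) * t) := by positivity
      have := hball (φ t z) (mem_ball_zero_iff.2
        (hB ▸ (hexp t ⟨ht.1, ht.2.le⟩).trans_lt hρr))
      rw [norm_norm, hB] at this
      linarith
  refine IsBigO.of_bound E ?_
  rw [eventually_unitTimes]
  have hsmall : ∀ᶠ z in 𝓝 (0 : ℂ), ‖z‖ * E < r := by
    have : Continuous fun z : ℂ => ‖z‖ * E := by fun_prop
    exact this.continuousAt.eventually_lt continuousAt_const (by simpa using hr)
  filter_upwards [h.map_zero, h.hasTimeDeriv, hsmall] with z hz0 hz hzs t ht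
  simp only [pow_one, norm_norm]
  rw [mul_comm]
  -- Letting `ρ` decrease to `‖z‖` also covers `z = 0`, where `ρ = ‖z‖` would not be positive.
  have hev : ∀ᶠ ρ : ℝ in 𝓝[>] ‖z‖, ‖φ t z‖ ≤ ρ * E := by
    have h1 : ∀ᶠ ρ : ℝ in 𝓝 ‖z‖, ρ * E < r := by
      have : Continuous fun ρ : ℝ => ρ * E := by fun_prop
      exact this.continuousAt.eventually_lt continuousAt_const hzs
    filter_upwards [nhdsWithin_le_nhds h1, self_mem_nhdsWithin] with ρ hρ1 hρ
    have hρ : ‖z‖ < ρ := hρ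
    exact trap z hz0 hz ρ ((norm_nonneg _).trans_lt hρ) hρ.le hρ1 t ht
  have hlim : Tendsto (fun ρ : ℝ => ρ * E) (𝓝[>] ‖z‖) (𝓝 (‖z‖ * E)) := by
    have : Continuous fun ρ : ℝ => ρ * E := by fun_prop
    exact (this.tendsto _).mono_left nhdsWithin_le_nhds
  exact ge_of_tendsto hlim hev

/-! ### Perturbation of the linear flow -/

/-- A homogeneous polynomial of degree `m + 1` has Lipschitz constant `O(r^m)` on balls of
radius `r`. -/
lemma homPoly_sub_isBigO (m : ℕ) (c : ℕ × ℕ → ℂ) :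
    (fun p : ℂ × ℂ => homPoly (m + 1) c p.1 - homPoly (m + 1) c p.2) =O[⊤]
      fun p => (‖p.1‖ + ‖p.2‖) ^ m * ‖p.1 - p.2‖ := by
  obtain ⟨K, hK⟩ := (((isPlanarPoly_homPoly (m + 1) c).contDiff 0 (n := 1)).contDiffOn
    (s := Metric.closedBall (0 : ℂ) 1)).exists_lipschitzOnWith (by simp)
    (convex_closedBall _ _) (isCompact_closedBall _ _)
  refine IsBigO.of_bound K (Eventually.of_forall fun ⟨z, w⟩ => ?_)
  dsimp only
  -- Both points divided by `r` lie in the closed unit ball, where a single Lipschitz constant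
  -- serves; homogeneity restores the scale.
  set r := ‖z‖ + ‖w‖ with hr
  rw [norm_mul, norm_norm, Real.norm_of_nonneg (by positivity)]
  rcases (show 0 ≤ r by positivity).eq_or_lt with h0 | h0
  · have hz : z = 0 := norm_eq_zero.1 (by linarith [norm_nonneg z, norm_nonneg w])
    have hw : w = 0 := norm_eq_zero.1 (by linarith [norm_nonneg z, norm_nonneg w])
    simp [hz, hw]
  · have hr0 : (r : ℂ) ≠ 0 := by exact_mod_cast h0.ne'
    have hmem : ∀ x : ℂ, ‖x‖ ≤ r → x / r ∈ Metric.closedBall (0 : ℂ) 1 := fun x hx => by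
      rw [mem_closedBall_zero_iff, norm_div, Complex.norm_real, Real.norm_of_nonneg h0.le]
      exact (div_le_one h0).2 hx
    have key := hK.norm_sub_le (hmem z (by linarith [norm_nonneg w]))
      (hmem w (by linarith [norm_nonneg z]))
    have hscale : ∀ x : ℂ, homPoly (m + 1) c x = (r : ℂ) ^ (m + 1) * homPoly (m + 1) c (x / r) :=
      fun x => by rw [← homPoly_ofReal_mul, mul_div_cancel₀ _ hr0]
    rw [← sub_div, norm_div, Complex.norm_real, Real.norm_of_nonneg h0.le] at key
    rw [hscale z, hscale w, ← mul_sub, norm_mul, norm_pow, Complex.norm_real,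
      Real.norm_of_nonneg h0.le]
    calc _ ≤ r ^ (m + 1) * (K * (‖z - w‖ / r)) := by gcongr
      _ = _ := by rw [pow_succ]; field_simp

lemma continuous_cexp_mul (μ : ℂ) : Continuous fun t : ℝ => Complex.exp (μ * t) := by fun_prop

lemma cexp_neg_mul_cancel (μ : ℂ) (t : ℝ) (z : ℂ) :
    Complex.exp (μ * t) * (Complex.exp (-μ * t) * z) = z := by
  rw [← mul_assoc, ← Complex.exp_add]; simp

section
variable {l : ℂ} {R S : ℂ → ℂ} {φ ψ : ℝ → ℂ → ℂ}

lemma IsQuadLipschitz.isBigO_add_linear (hR : IsQuadLipschitz R) (l : ℂ) :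
    (fun z => l * z + R z) =O[𝓝 0] fun z => ‖z‖ := by
  refine ((isBigO_refl (fun z : ℂ => z) _).norm_right.const_mul_left l).add (hR.isBigO.trans ?_)
  simpa using isBigO_norm_pow_of_le (k := 1) (m := 2) (by norm_num)

/-- The Lipschitz constant of `R` along the orbits is `O(|z|)`, so applying `R` gains one order over
the distance between them. This gain drives the order-by-order arguments below. -/
lemma IsQuadLipschitz.isBigO_comp_sub (hR : IsQuadLipschitz R)
    (hφ : (fun p : ℂ × ℝ => φ p.2 p.1) =O[unitTimes] fun p => ‖p.1‖ ^ 1)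
    (hψ : (fun p : ℂ × ℝ => ψ p.2 p.1) =O[unitTimes] fun p => ‖p.1‖ ^ 1)
    {g : ℂ × ℝ → ℝ} (hs : (fun p : ℂ × ℝ => φ p.2 p.1 - ψ p.2 p.1) =O[unitTimes] g) :
    (fun p : ℂ × ℝ => R (φ p.2 p.1) - R (ψ p.2 p.1)) =O[unitTimes] fun p => ‖p.1‖ * g p := by
  have ht : ∀ {φ : ℝ → ℂ → ℂ}, ((fun p : ℂ × ℝ => φ p.2 p.1) =O[unitTimes] fun p => ‖p.1‖ ^ 1) →
      Tendsto (fun p : ℂ × ℝ => φ p.2 p.1) unitTimes (𝓝 0) := fun hφ => by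
    refine hφ.trans_tendsto ?_
    simpa [Function.comp_def] using (tendsto_norm_zero (E := ℂ)).comp tendsto_fst_unitTimes
  refine (hR.isBigO_sub.comp_tendsto ((ht hφ).prodMk_nhds (ht hψ))).trans ?_
  refine IsBigO.mul ?_ hs.norm_left
  simpa using hφ.norm_left.add hψ.norm_left

/-- In the coordinates `exp(-lt) φ`, the field `l z + R(z)` becomes `exp(-lt) R`. -/
lemma IsUnitFlow.hasTimeDeriv_rotate (hφ : IsUnitFlow (fun z => l * z + R z) φ) :
    HasTimeDeriv (fun t z => Complex.exp (-l * t) * φ t z)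
      fun t z => Complex.exp (-l * t) * R (φ t z) := by
  filter_upwards [hφ.hasTimeDeriv] with z hz t ht
  have h1 : HasDerivAt (fun t : ℝ => Complex.exp (-l * t)) (Complex.exp (-l * t) * -l) t := by
    simpa using ((Complex.ofRealCLM.hasDerivAt (x := t)).const_mul (-l)).cexp
  exact (h1.hasDerivWithinAt.mul (hz t ht)).congr_deriv (by ring)

lemma IsUnitFlow.isBigO_of_isQuadLipschitz (hφ : IsUnitFlow (fun z => l * z + R z) φ)
    (hR : IsQuadLipschitz R) :
    (fun p : ℂ × ℝ => φ p.2 p.1) =O[unitTimes] fun p => ‖p.1‖ ^ 1 :=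
  hφ.isBigO (hR.isBigO_add_linear l)

/-- To first order, the flow of `l z + R(z)` is the linear flow. -/
lemma IsUnitFlow.isBigO_sub_linear (hφ : IsUnitFlow (fun z => l * z + R z) φ)
    (hR : IsQuadLipschitz R) {m : ℕ} (hRm : R =O[𝓝 0] fun z => ‖z‖ ^ m) :
    (fun p : ℂ × ℝ => φ p.2 p.1 - Complex.exp (l * p.2) * p.1) =O[unitTimes]
      fun p => ‖p.1‖ ^ m := by
  have hd : HasTimeDeriv (fun t z => Complex.exp (-l * t) * φ t z - z)
      fun t z => Complex.exp (-l * t) * R (φ t z) := by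
    filter_upwards [hφ.hasTimeDeriv_rotate] with z hz t ht using (hz t ht).sub_const z
  have := hd.isBigO_of_deriv' (by filter_upwards [hφ.map_zero] with z hz; simp [hz])
    (isBigO_coeff_mul (continuous_cexp_mul (-l))
      (isBigO_comp hRm (hφ.isBigO_of_isQuadLipschitz hR)))
  refine (isBigO_coeff_mul (continuous_cexp_mul l) this).congr_left fun p => ?_
  rw [mul_sub, cexp_neg_mul_cancel]

/-- The flow of a polynomial field has a Taylor expansion in the initial point. -/
lemma IsUnitFlow.exists_isPolyFamily (hφ : IsUnitFlow (fun z => l * z + R z) φ)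
    (hR : IsQuadLipschitz R) (hRp : IsPlanarPoly R) (m : ℕ) :
    ∃ P, IsPolyFamily P ∧
      (fun p : ℂ × ℝ => φ p.2 p.1 - P p.2 p.1) =O[unitTimes] fun p => ‖p.1‖ ^ (m + 1) := by
  have hφ1 := hφ.isBigO_of_isQuadLipschitz hR
  induction m with
  | zero =>
    exact ⟨fun _ _ => 0, .coeff continuous_const, by simpa using hφ1⟩
  | succ m ih =>
    obtain ⟨P, hP, hO⟩ := ih
    have hP1 : (fun p : ℂ × ℝ => P p.2 p.1) =O[unitTimes] fun p => ‖p.1‖ ^ 1 :=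
      (hφ1.sub (hO.trans (isBigO_unitTimes_pow_of_le (by omega)))).congr_left fun p => by ring
    have hRP : IsPolyFamily fun t z => Complex.exp (-l * t) * R (P t z) :=
      (IsPolyFamily.comp hRp hP).coeff_mul (continuous_cexp_mul (-l))
    -- One Picard iteration in rotating coordinates; it raises the order of the error by one.
    refine ⟨fun t z => Complex.exp (l * t) *
      (z + ∫ s in (0 : ℝ)..t, Complex.exp (-l * s) * R (P s z)),
      (IsPolyFamily.var.add hRP.integral).coeff_mul (continuous_cexp_mul l), ?_⟩
    have hd : HasTimeDeriv (fun t z => Complex.exp (-l * t) * φ t z - z -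
        ∫ s in (0 : ℝ)..t, Complex.exp (-l * s) * R (P s z))
        fun t z => Complex.exp (-l * t) * R (φ t z) - Complex.exp (-l * t) * R (P t z) := by
      filter_upwards [hφ.hasTimeDeriv_rotate, HasTimeDeriv.integral hRP] with z hz hi t ht
      exact ((hz t ht).sub_const z).sub (hi t ht)
    have := hd.isBigO_of_deriv' (m := m + 2)
      (by filter_upwards [hφ.map_zero] with z hz; simp [hz]) (by
        simp_rw [← mul_sub]
        refine isBigO_coeff_mul (continuous_cexp_mul (-l)) ?_
        exact (hR.isBigO_comp_sub hφ1 hP1 hO).congr_right fun p => by ring)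
    refine (isBigO_coeff_mul (continuous_cexp_mul l) this).congr_left fun p => ?_
    rw [mul_sub, mul_sub, cexp_neg_mul_cancel]
    ring

/-! ### Resonance factors and the leading difference of time-one maps -/

/-- The factor by which the time-one map multiplies the coefficient of `z^j z̄^k` of the field. -/
noncomputable def resonanceFactor (l : ℂ) (p : ℕ × ℕ) : ℂ :=
  ∫ s in (0 : ℝ)..1, Complex.exp ((l * p.1 + conj l * p.2 - l) * s)

/-- Along the linear flow the monomial `z^j z̄^k` is multiplied by `exp((l j + l̄ k) s)`, so each
monomial contributes its own scalar integral. -/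
lemma integral_homPoly_linear (l : ℂ) (m : ℕ) (c : ℕ × ℕ → ℂ) (z : ℂ) :
    ∫ s in (0 : ℝ)..1, Complex.exp (-l * s) * homPoly m c (Complex.exp (l * s) * z) =
      homPoly m (fun p => c p * resonanceFactor l p) z := by
  simp only [homPoly, Finset.mul_sum]
  rw [intervalIntegral.integral_finsetSum
    fun p _ => Continuous.intervalIntegrable (by fun_prop) _ _]
  refine Finset.sum_congr rfl fun p _ => ?_
  rw [resonanceFactor, mul_assoc, mul_assoc, mul_comm (∫ _ in _.._, _), ← mul_assoc,
    ← mul_assoc, ← intervalIntegral.integral_const_mul]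
  refine intervalIntegral.integral_congr fun s _ => ?_
  have hc : conj (Complex.exp (l * s)) = Complex.exp (conj l * s) := by
    rw [← Complex.exp_conj]; simp
  have he : Complex.exp ((l * p.1 + conj l * p.2 - l) * s) = Complex.exp (-l * s) *
      (Complex.exp (l * s) ^ p.1 * Complex.exp (conj l * s) ^ p.2) := by
    rw [← Complex.exp_nat_mul, ← Complex.exp_nat_mul, ← Complex.exp_add, ← Complex.exp_add]
    congr 1; ring
  simp only [map_mul, hc, he, mul_pow]
  ring

/-- If two fields with the same linear part first differ in degree `m + 1`, the time-one maps
first differ in that degree, by the difference of the fields with coefficients multiplied by the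
resonance factors. -/
lemma IsUnitFlow.isBigO_sub_homPoly (hφ : IsUnitFlow (fun z => l * z + R z) φ)
    (hψ : IsUnitFlow (fun z => l * z + S z) ψ) (hR : IsQuadLipschitz R) (hS : IsQuadLipschitz S)
    {m : ℕ} {c : ℕ × ℕ → ℂ}
    (h : (fun z => R z - S z - homPoly (m + 1) c z) =O[𝓝 0] fun z => ‖z‖ ^ (m + 2)) :
    (fun z => φ 1 z - ψ 1 z - Complex.exp l *
      homPoly (m + 1) (fun p => c p * resonanceFactor l p) z) =O[𝓝 0] fun z => ‖z‖ ^ (m + 2) := by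
  have hφ1 := hφ.isBigO_of_isQuadLipschitz hR
  have hψ1 := hψ.isBigO_of_isQuadLipschitz hS
  have hRS : (fun z => R z - S z) =O[𝓝 0] fun z => ‖z‖ ^ (m + 1) :=
    ((h.trans (isBigO_norm_pow_of_le (by omega))).add (homPoly_isBigO (m + 1) c)).congr_left
      fun z => by ring
  -- A first bound, of the order of `R - S`, from Grönwall applied to `R(φ) - R(ψ) + (R - S)(ψ)`; it
  -- is then fed back to control `R(φ) - R(ψ)` to one order more.
  have hdiff : (fun p : ℂ × ℝ => φ p.2 p.1 - ψ p.2 p.1) =O[unitTimes]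
      fun p => ‖p.1‖ ^ (m + 1) := by
    have hd := hφ.hasTimeDeriv_rotate.sub hψ.hasTimeDeriv_rotate
    have := hd.isBigO_of_deriv (m := m + 1)
      (by filter_upwards [hφ.map_zero, hψ.map_zero] with z hz hz'; simp [hz, hz']) (by
        simp_rw [← mul_sub]
        refine isBigO_coeff_mul (continuous_cexp_mul (-l)) ?_
        have e1 : (fun p : ℂ × ℝ => R (φ p.2 p.1) - R (ψ p.2 p.1)) =O[unitTimes]
            fun p => ‖Complex.exp (-l * p.2) * (φ p.2 p.1 - ψ p.2 p.1)‖ := by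
          have h1 := (isBigO_coeff_mul (continuous_cexp_mul l) (isBigO_refl (fun p : ℂ × ℝ =>
            Complex.exp (-l * p.2) * (φ p.2 p.1 - ψ p.2 p.1)) unitTimes).norm_right).congr_left
            fun p => cexp_neg_mul_cancel l p.2 _
          refine (hR.isBigO_comp_sub hφ1 hψ1 h1).trans ?_
          have h2 : (fun p : ℂ × ℝ => ‖p.1‖) =O[unitTimes] fun _ => (1 : ℝ) := by
            simpa using isBigO_unitTimes_pow_of_le (k := 0) (m := 1) (by norm_num)
          simpa using h2.mul (isBigO_refl (fun p : ℂ × ℝ =>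
            ‖Complex.exp (-l * p.2) * (φ p.2 p.1 - ψ p.2 p.1)‖) unitTimes)
        have e2 := isBigO_comp hRS hψ1
        have hsum : ∀ f g : ℂ × ℝ → ℝ, (∀ p, 0 ≤ f p) → (∀ p, 0 ≤ g p) →
            f =O[unitTimes] (fun p => f p + g p) ∧ g =O[unitTimes] fun p => f p + g p := by
          intro f g hf hg
          constructor <;> refine IsBigO.of_bound 1 (Eventually.of_forall fun p => ?_) <;>
          · rw [Real.norm_of_nonneg (by simp [hf, hg]),
              Real.norm_of_nonneg (add_nonneg (hf p) (hg p))]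
            linarith [hf p, hg p]
        obtain ⟨s1, s2⟩ := hsum (fun p => ‖Complex.exp (-l * p.2) * (φ p.2 p.1 - ψ p.2 p.1)‖)
          (fun p => ‖p.1‖ ^ (m + 1)) (fun p => by positivity) (fun p => by positivity)
        exact ((e1.trans s1).add (e2.trans s2)).congr_left fun p => by ring)
    refine (isBigO_coeff_mul (continuous_cexp_mul l) this).congr_left fun p => ?_
    rw [← mul_sub, cexp_neg_mul_cancel]
  have hhom : IsPolyFamily fun t z =>
      Complex.exp (-l * t) * homPoly (m + 1) c (Complex.exp (l * t) * z) :=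
    (IsPolyFamily.comp (isPlanarPoly_homPoly (m + 1) c)
      (IsPolyFamily.var.coeff_mul (continuous_cexp_mul l))).coeff_mul (continuous_cexp_mul (-l))
  -- After subtracting the integral of the homogeneous part along the linear flow, three errors of
  -- order `m + 2` remain: `R(φ) - R(ψ)`, the tail of `R - S` along `ψ`, and the replacement of `ψ`
  -- by the linear flow inside the homogeneous part.
  have hd := (hφ.hasTimeDeriv_rotate.sub hψ.hasTimeDeriv_rotate).sub (HasTimeDeriv.integral hhom)
  have hmain := hd.isBigO_of_deriv' (m := m + 2)
    (by filter_upwards [hφ.map_zero, hψ.map_zero] with z hz hz'; simp [hz, hz']) (by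
      simp_rw [← mul_sub]
      refine isBigO_coeff_mul (continuous_cexp_mul (-l)) ?_
      have e1 := (hR.isBigO_comp_sub hφ1 hψ1 hdiff).congr_right
        (g₂ := fun p => ‖p.1‖ ^ (m + 2)) fun p => by ring
      have e2 := isBigO_comp h hψ1
      have hlin : (fun p : ℂ × ℝ => Complex.exp (l * p.2) * p.1) =O[unitTimes]
          fun p => ‖p.1‖ ^ 1 :=
        isBigO_coeff_mul (continuous_cexp_mul l) (by
          simpa using (isBigO_refl (fun p : ℂ × ℝ => p.1) unitTimes).norm_right)
      have e3 : (fun p : ℂ × ℝ => homPoly (m + 1) c (ψ p.2 p.1) -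
          homPoly (m + 1) c (Complex.exp (l * p.2) * p.1)) =O[unitTimes]
          fun p => ‖p.1‖ ^ (m + 2) := by
        refine ((homPoly_sub_isBigO m c).comp_tendsto (k := fun p : ℂ × ℝ =>
          (ψ p.2 p.1, Complex.exp (l * p.2) * p.1)) tendsto_top).trans ?_
        have := ((hψ1.norm_left.add hlin.norm_left).pow m).mul
          (hψ.isBigO_sub_linear hS hS.isBigO).norm_left
        refine this.congr_right fun p => ?_
        ring
      exact ((e1.add e2).add e3).congr_left fun p => by ring)
  have hone := isBigO_at_one (f := fun t z =>
    Complex.exp (-l * t) * φ t z - Complex.exp (-l * t) * ψ t z -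
      ∫ s in (0 : ℝ)..t, Complex.exp (-l * s) * homPoly (m + 1) c (Complex.exp (l * s) * z)) hmain
  refine (hone.const_mul_left (Complex.exp l)).congr_left fun z => ?_
  rw [integral_homPoly_linear, mul_sub, mul_sub]
  have := fun w => cexp_neg_mul_cancel l 1 w
  simp only [Complex.ofReal_one, mul_one] at this
  simp [this]

lemma resonanceFactor_eq (l : ℂ) (p : ℕ × ℕ) (h : l * p.1 + conj l * p.2 - l ≠ 0) :
    resonanceFactor l p =
      (Complex.exp (l * p.1 + conj l * p.2 - l) - 1) / (l * p.1 + conj l * p.2 - l) := by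
  rw [resonanceFactor, integral_exp_mul_complex h]
  simp

/-- With exponent `μ` the integral is `1` if `μ = 0` and `(exp μ - 1) / μ` otherwise. -/
lemma resonanceFactor_ne_zero (l : ℂ) (p : ℕ × ℕ)
    (h : Complex.exp (l * p.1 + conj l * p.2 - l) = 1 → l * p.1 + conj l * p.2 - l = 0) :
    resonanceFactor l p ≠ 0 := by
  by_cases h0 : l * p.1 + conj l * p.2 - l = 0
  · simp [resonanceFactor, h0]
  · rw [resonanceFactor_eq l p h0]
    exact div_ne_zero (sub_ne_zero.2 fun h1 => h0 (h h1)) h0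

/-! ### Existence of the flow up to time one -/

/-- Flows up to time one exist near the origin. -/
lemma exists_isUnitFlow (l : ℂ) (hR : IsQuadLipschitz R) (hc : Continuous R) :
    ∃ φ, IsUnitFlow (fun z => l * z + R z) φ := by
  obtain ⟨C, hC, hb⟩ := hR.isBigO_sub.exists_pos
  obtain ⟨r, hr, hball⟩ := Metric.eventually_nhds_iff_ball.1 hb.bound
  set M := Real.exp ‖l‖
  have hM : 1 ≤ M := Real.one_le_exp (norm_nonneg l)
  have hM0 : 0 < M := by positivity
  -- The first bound keeps rotated points in the ball where the estimate on `R` holds. The second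
  -- gives `C M³ a ≤ 1/2`, so the rotated field has Lipschitz constant at most `1` and size at most
  -- `a/2` on the ball of radius `a`; solutions starting within `a/2` then stay in it until time
  -- `1`. In the original coordinates the linear term would not be small in this sense.
  set a := min (r / (2 * M)) (1 / (2 * C * M ^ 3)) with ha
  have ha0 : 0 < a := lt_min (by positivity) (by positivity)
  have har : M * a < r := by
    have : a ≤ r / (2 * M) := min_le_left _ _
    rw [le_div_iff₀ (by positivity)] at this
    nlinarith
  have hac : C * M ^ 3 * a ≤ 1 / 2 := by
    have : a ≤ 1 / (2 * C * M ^ 3) := min_le_right _ _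
    rw [le_div_iff₀ (by positivity)] at this
    linarith
  have hexp : ∀ μ : ℂ, ‖μ‖ = ‖l‖ → ∀ t ∈ Icc (0 : ℝ) 1, ‖Complex.exp (μ * t)‖ ≤ M := by
    intro μ hμ t ht
    refine (Complex.norm_exp_le_exp_norm _).trans (Real.exp_le_exp.2 ?_)
    rw [norm_mul, Complex.norm_real, Real.norm_of_nonneg ht.1, hμ]
    exact mul_le_of_le_one_right (norm_nonneg l) ht.2
  have hlip : ∀ t ∈ Icc (0 : ℝ) 1, ∀ u ∈ Metric.closedBall (0 : ℂ) a,
      ∀ v ∈ Metric.closedBall (0 : ℂ) a,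
      ‖Complex.exp (-l * t) * R (Complex.exp (l * t) * u) -
        Complex.exp (-l * t) * R (Complex.exp (l * t) * v)‖ ≤
        C * M ^ 3 * (‖u‖ + ‖v‖) * ‖u - v‖ := by
    intro t ht u hu v hv
    have h1 := hexp l rfl t ht
    have h2 := hexp (-l) (norm_neg l) t ht
    rw [mem_closedBall_zero_iff] at hu hv
    have hle : ∀ u : ℂ, ‖Complex.exp (l * t) * u‖ ≤ M * ‖u‖ := fun u => by
      rw [norm_mul]; gcongr
    have hlt : ∀ u : ℂ, ‖u‖ ≤ a → ‖Complex.exp (l * t) * u‖ < r := fun u hu =>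
      (hle u).trans_lt ((mul_le_mul_of_nonneg_left hu hM0.le).trans_lt har)
    have h3 := hball (Complex.exp (l * t) * u, Complex.exp (l * t) * v) (by
      rw [mem_ball_zero_iff, Prod.norm_def]; exact max_lt (hlt u hu) (hlt v hv))
    dsimp only at h3
    rw [norm_mul, norm_norm, Real.norm_of_nonneg (by positivity), ← mul_sub] at h3
    rw [← mul_sub, norm_mul]
    calc _ ≤ M * (C * ((M * ‖u‖ + M * ‖v‖) * (M * ‖u - v‖))) := by
          refine mul_le_mul h2 (h3.trans ?_) (norm_nonneg _) hM0.le
          gcongr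
          · exact hle u
          · exact hle v
          · exact hle _
      _ = _ := by ring
  lift a to NNReal using ha0.le with a'
  have hpl : IsPicardLindelof (fun t u => Complex.exp (-l * t) * R (Complex.exp (l * t) * u))
      (tmin := 0) (tmax := 1) ⟨0, by simp⟩ (0 : ℂ) a' (a' / 2) (a' / 2) 1 := by
    refine ⟨fun t ht => ?_, fun x _ => ?_, fun t ht x hx => ?_, ?_⟩
    · refine LipschitzOnWith.of_dist_le_mul fun u hu v hv => ?_
      rw [dist_eq_norm, dist_eq_norm]
      refine (hlip t ht u hu v hv).trans ?_
      rw [mem_closedBall_zero_iff] at hu hv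
      gcongr
      have : C * M ^ 3 * (‖u‖ + ‖v‖) ≤ C * M ^ 3 * (a' + a') := by gcongr
      simp only [NNReal.coe_one]
      linarith
    · exact Continuous.continuousOn (by fun_prop)
    · have := hlip t ht x hx 0 (by simp)
      rw [mem_closedBall_zero_iff] at hx
      simp only [mul_zero, hR.map_zero, sub_zero, norm_zero, add_zero] at this
      refine this.trans ?_
      have : C * M ^ 3 * ‖x‖ * ‖x‖ ≤ C * M ^ 3 * a' * a' := by gcongr
      push_cast
      nlinarith
    · push_cast
      simp only [sub_zero, sub_self, max_eq_left zero_le_one, mul_one]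
      linarith
  obtain ⟨α, hα⟩ := hpl.exists_forall_mem_closedBall_eq_forall_mem_Icc_hasDerivWithinAt
  refine ⟨fun t z => Complex.exp (l * t) * α z t, ?_, ?_⟩
  · filter_upwards [Metric.closedBall_mem_nhds (0 : ℂ) (show (0 : ℝ) < (a' / 2 : NNReal) by
      push_cast; linarith)] with z hz
    simpa using (hα z hz).1
  · filter_upwards [Metric.closedBall_mem_nhds (0 : ℂ) (show (0 : ℝ) < (a' / 2 : NNReal) by
      push_cast; linarith)] with z hz t ht
    have h1 : HasDerivAt (fun t : ℝ => Complex.exp (l * t)) (Complex.exp (l * t) * l) t := by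
      simpa using ((Complex.ofRealCLM.hasDerivAt (x := t)).const_mul l).cexp
    refine (h1.hasDerivWithinAt.mul ((hα z hz).2 t ht)).congr_deriv ?_
    rw [cexp_neg_mul_cancel]
    ring

end

/-! ### The nonresonant case: existence and uniqueness -/

/-- The polynomial `∑_{2 ≤ j + k ≤ n} c_{j,k} z^j z̄^k`. -/
noncomputable def nonlinearPoly (n : ℕ) (c : ℕ × ℕ → ℂ) (z : ℂ) : ℂ :=
  ∑ k ∈ Finset.Ico 2 (n + 1), homPoly k c z

lemma mem_nonlinearExponents {n : ℕ} {p : ℕ × ℕ} :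
    p ∈ nonlinearExponents n ↔ 2 ≤ p.1 + p.2 ∧ p.1 + p.2 ≤ n := by
  simp only [nonlinearExponents, Finset.mem_filter, Finset.mem_product, Finset.mem_range]
  omega

lemma planarPoly_eq (l : ℂ) (n : ℕ) (c : ℕ × ℕ → ℂ) (z : ℂ) :
    planarPoly l n (fun p => c p.1) z = l * z + nonlinearPoly n c z := by
  have hset : nonlinearExponents n =
      (Finset.Ico 2 (n + 1)).biUnion Finset.HasAntidiagonal.antidiagonal := by
    ext p
    rw [mem_nonlinearExponents]
    simp
  rw [planarPoly, nonlinearPoly, Finset.univ_eq_attach,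
    Finset.sum_attach _ fun p : ℕ × ℕ => c p * z ^ p.1 * conj z ^ p.2, hset,
    Finset.sum_biUnion]
  · rfl
  · intro i _ j _ hij
    refine Finset.disjoint_left.2 fun p hp hq => hij ?_
    rw [← Finset.HasAntidiagonal.mem_antidiagonal.1 hp,
      ← Finset.HasAntidiagonal.mem_antidiagonal.1 hq]

lemma exists_coeff_eq (n : ℕ) (a : nonlinearExponents n → ℂ) :
    ∃ c : ℕ × ℕ → ℂ, a = fun p => c p.1 := by
  classical
  exact ⟨fun p => if h : p ∈ nonlinearExponents n then a ⟨p, h⟩ else 0, by ext p; simp⟩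

lemma isPlanarPoly_nonlinearPoly (n : ℕ) (c : ℕ × ℕ → ℂ) : IsPlanarPoly (nonlinearPoly n c) :=
  IsPolyFamily.sum (f := fun k _ => homPoly k c) fun k _ => isPlanarPoly_homPoly k c

lemma nonlinearPoly_isBigO (n : ℕ) (c : ℕ × ℕ → ℂ) :
    nonlinearPoly n c =O[𝓝 0] fun z => ‖z‖ ^ 2 :=
  IsBigO.fun_sum fun k hk =>
    (homPoly_isBigO k c).trans (isBigO_norm_pow_of_le (Finset.mem_Ico.1 hk).1)

lemma continuous_nonlinearPoly (n : ℕ) (c : ℕ × ℕ → ℂ) : Continuous (nonlinearPoly n c) :=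
  ((isPlanarPoly_nonlinearPoly n c).contDiff 0 (n := 0)).continuous

lemma isQuadLipschitz_nonlinearPoly (n : ℕ) (c : ℕ × ℕ → ℂ) :
    IsQuadLipschitz (nonlinearPoly n c) :=
  isQuadLipschitz_of_contDiffAt ((isPlanarPoly_nonlinearPoly n c).contDiff 0).contDiffAt
    (eq_zero_of_isBigO_norm_pow two_ne_zero (nonlinearPoly_isBigO n c))
    (hasFDerivAt_zero_of_isBigO (nonlinearPoly_isBigO n c)).fderiv

lemma IsUnitTimeFlowNearZero.isUnitFlow {U : Set ℂ} {X : ℂ → ℂ} {φ : ℝ → ℂ → ℂ}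
    (h : IsUnitTimeFlowNearZero U X φ) : IsUnitFlow X φ :=
  ⟨h.mono fun _ hz => hz.1, h.mono fun _ hz t ht => hz.2.2 t ht⟩

lemma IsUnitFlow.isUnitTimeFlowNearZero {X : ℂ → ℂ} {φ : ℝ → ℂ → ℂ} (h : IsUnitFlow X φ) :
    IsUnitTimeFlowNearZero univ X φ := by
  filter_upwards [h.map_zero, h.hasTimeDeriv] with z hz hd
  exact ⟨hz, fun _ _ => Set.mem_univ _, hd⟩

/-- Without resonances, a polynomial map tangent to `exp(l) z` is the time-one map of a polynomial
field up to any given order. -/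
lemma exists_field_of_resonanceFactor_ne_zero {l : ℂ} (hl : ∀ p, resonanceFactor l p ≠ 0)
    {F : ℂ → ℂ} (hF : IsPlanarPoly F)
    (hF1 : (fun z => F z - Complex.exp l * z) =O[𝓝 0] fun z => ‖z‖ ^ 2) {n : ℕ} (hn : 1 ≤ n) :
    ∃ c φ, IsUnitFlow (fun z => l * z + nonlinearPoly n c z) φ ∧
      (fun z => φ 1 z - F z) =O[𝓝 0] fun z => ‖z‖ ^ (n + 1) := by
  induction n, hn using Nat.le_induction with
  -- At `n = 1` the nonlinear part is an empty sum, and the field is linear.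
  | base =>
    obtain ⟨φ, hφ⟩ := exists_isUnitFlow l (isQuadLipschitz_nonlinearPoly 1 0)
      (continuous_nonlinearPoly 1 0)
    refine ⟨0, φ, hφ, ?_⟩
    have := isBigO_at_one (f := fun t z => φ t z - Complex.exp (l * t) * z)
      (hφ.isBigO_sub_linear (isQuadLipschitz_nonlinearPoly 1 0) (nonlinearPoly_isBigO 1 0))
    refine (this.sub hF1).congr_left fun z => ?_
    simp
  | succ n hn ih =>
    obtain ⟨c, φ, hφ, hO⟩ := ih
    -- The Taylor polynomial of the flow turns the error `φ 1 - F` into a polynomial modulo order `n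
    -- + 2`, so that it has a leading homogeneous part `d`.
    obtain ⟨P, hP, hPO⟩ := hφ.exists_isPolyFamily (isQuadLipschitz_nonlinearPoly n c)
      (isPlanarPoly_nonlinearPoly n c) (n + 1)
    have hP1 := isBigO_at_one (f := fun t z => φ t z - P t z) hPO
    have hPF : IsPlanarPoly fun z => P 1 z - F z :=
      (IsPolyFamily.add (hP.isPlanarPoly 1) (IsPolyFamily.coeff_mul hF
        (continuous_const (y := (-1 : ℂ))))).congr fun _ z => by ring
    obtain ⟨d, hd⟩ := hPF.exists_homPoly (m := n + 1)
      ((hO.sub (hP1.trans (isBigO_norm_pow_of_le (by omega)))).congr_left fun z => by ring)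
    -- This solves `exp(l) ρ_p e_p = -d_p`, so that adding `e` to the field cancels `d` in the
    -- time-one map.
    set e : ℕ × ℕ → ℂ := fun p => -d p / (Complex.exp l * resonanceFactor l p) with he
    set c' : ℕ × ℕ → ℂ := fun p => if p.1 + p.2 = n + 1 then e p else c p with hc'
    obtain ⟨ψ, hψ⟩ := exists_isUnitFlow l (isQuadLipschitz_nonlinearPoly (n + 1) c')
      (continuous_nonlinearPoly (n + 1) c')
    refine ⟨c', ψ, hψ, ?_⟩
    have hsplit : ∀ z, nonlinearPoly (n + 1) c' z = nonlinearPoly n c z + homPoly (n + 1) e z := by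
      intro z
      rw [nonlinearPoly, Finset.sum_Ico_succ_top (by omega), nonlinearPoly]
      congr 1
      · refine Finset.sum_congr rfl fun k hk => homPoly_congr (fun p hp => ?_) z
        have := Finset.HasAntidiagonal.mem_antidiagonal.1 hp
        have := Finset.mem_Ico.1 hk
        exact if_neg (by omega)
      · refine homPoly_congr (fun p hp => ?_) z
        exact if_pos (Finset.HasAntidiagonal.mem_antidiagonal.1 hp)
    have key := hψ.isBigO_sub_homPoly hφ (isQuadLipschitz_nonlinearPoly _ _)
      (isQuadLipschitz_nonlinearPoly _ _) (m := n) (c := e)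
      ((isBigO_zero _ _).congr_left fun z => by rw [hsplit]; ring)
    have hed : ∀ z, Complex.exp l * homPoly (n + 1) (fun p => e p * resonanceFactor l p) z =
        -homPoly (n + 1) d z := by
      intro z
      rw [← homPoly_smul, neg_eq_neg_one_mul, ← homPoly_smul]
      refine homPoly_congr (fun p _ => ?_) z
      have := hl p
      have := Complex.exp_ne_zero l
      simp only [Pi.smul_apply, smul_eq_mul, he]
      field_simp
    refine ((key.add hP1).add hd).congr_left fun z => ?_
    rw [hed]
    ring

/-- Without resonances, the time-one map determines the coefficients of a polynomial field. -/
lemma coeff_eq_of_resonanceFactor_ne_zero {l : ℂ} (hl : ∀ p, resonanceFactor l p ≠ 0)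
    {n : ℕ} {c d : ℕ × ℕ → ℂ} {φ ψ : ℝ → ℂ → ℂ}
    (hφ : IsUnitFlow (fun z => l * z + nonlinearPoly n c z) φ)
    (hψ : IsUnitFlow (fun z => l * z + nonlinearPoly n d z) ψ)
    (h : (fun z => φ 1 z - ψ 1 z) =O[𝓝 0] fun z => ‖z‖ ^ (n + 1)) {m : ℕ} (hm : 1 ≤ m)
    (hmn : m ≤ n) :
    ∀ p : ℕ × ℕ, 2 ≤ p.1 + p.2 → p.1 + p.2 ≤ m → c p = d p := by
  induction m, hm using Nat.le_induction with
  | base => intro p h1 h2; omega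
  | succ m hm ih =>
    have ih := ih (by omega)
    have hdiff : ∀ z, nonlinearPoly n c z - nonlinearPoly n d z - homPoly (m + 1) (c - d) z =
        ∑ k ∈ Finset.Ico (m + 2) (n + 1), homPoly k (c - d) z := by
      intro z
      simp only [nonlinearPoly]
      rw [← Finset.sum_sub_distrib, ← Finset.sum_Ico_consecutive _ (show 2 ≤ m + 1 by omega)
        (show m + 1 ≤ n + 1 by omega), Finset.sum_eq_sum_Ico_succ_bot (show m + 1 < n + 1 by omega),
        Finset.sum_eq_zero]
      · simp_rw [homPoly_sub]
        ring
      · intro k hk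
        have := Finset.mem_Ico.1 hk
        rw [sub_eq_zero]
        refine homPoly_congr (fun p hp => ?_) z
        have := Finset.HasAntidiagonal.mem_antidiagonal.1 hp
        exact ih p (by omega) (by omega)
    have key := hφ.isBigO_sub_homPoly hψ (isQuadLipschitz_nonlinearPoly _ _)
      (isQuadLipschitz_nonlinearPoly _ _) (m := m) (c := c - d)
      (IsBigO.congr_left (IsBigO.fun_sum (s := Finset.Ico (m + 2) (n + 1)) fun k hk =>
        (homPoly_isBigO k (c - d)).trans (isBigO_norm_pow_of_le (Finset.mem_Ico.1 hk).1))
        fun z => (hdiff z).symm)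
    -- The leading difference of the time-one maps is the difference of the coefficients times
    -- nonzero factors, and it vanishes to higher order.
    have h0 := ((h.trans (isBigO_norm_pow_of_le (show m + 2 ≤ n + 1 by omega))).sub key).congr_left
      (f₂ := homPoly (m + 1) (Complex.exp l • fun p => (c - d) p * resonanceFactor l p))
      fun z => by rw [homPoly_smul]; ring
    intro p h1 h2
    by_cases hpm : p.1 + p.2 = m + 1
    · have := coeff_eq_zero_of_isBigO h0 p (Finset.HasAntidiagonal.mem_antidiagonal.2 hpm)
      simpa [hl p, Complex.exp_ne_zero, sub_eq_zero] using this
    · exact ih p h1 (by omega)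

/-- The eigenvalue `iα` has no resonances when `exp(iα)` is not a root of unity. -/
lemma resonanceFactor_ne_zero_of_not_rootOfUnity {α : ℝ}
    (hroot : ∀ m : ℕ, 1 ≤ m → Complex.exp (Complex.I * α) ^ m ≠ 1) (p : ℕ × ℕ) :
    resonanceFactor (Complex.I * α) p ≠ 0 := by
  refine resonanceFactor_ne_zero _ _ fun h => ?_
  have hconj : conj (Complex.I * (α : ℂ)) = -(Complex.I * α) := by simp
  rw [hconj] at h ⊢
  have hint : Complex.I * (α : ℂ) * p.1 + -(Complex.I * α) * p.2 - Complex.I * α =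
      ((p.1 - p.2 - 1 : ℤ) : ℂ) * (Complex.I * α) := by push_cast; ring
  rw [hint] at h ⊢
  rw [Complex.exp_int_mul] at h
  have hz : ((p.1 : ℤ) - p.2 - 1) = 0 := by
    by_contra hne
    obtain ⟨m, hm | hm⟩ := Int.eq_nat_or_neg ((p.1 : ℤ) - p.2 - 1) <;> rw [hm] at h hne
    · exact hroot m (by omega) (by simpa using h)
    · exact hroot m (by omega) (by simpa using h)
  simp [hz]

/-- Existence and uniqueness of the polynomial field of degree `n` in the nonresonant case. -/
theorem existsUnique_ellipticField {α : ℝ}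
    (hroot : ∀ m : ℕ, 1 ≤ m → Complex.exp (Complex.I * α) ^ m ≠ 1) (N : ℕ)
    (f : nonlinearExponents N → ℂ) (n : ℕ) (hn : 2 ≤ n) :
    ∃! a : nonlinearExponents n → ℂ,
      TimeOneMapAgreesToOrder univ (ellipticField α n a) (ellipticMap α N f) n := by
  have hl := resonanceFactor_ne_zero_of_not_rootOfUnity hroot
  have hfield : ∀ c : ℕ × ℕ → ℂ, ellipticField α n (fun p => c p.1) =
      fun z => Complex.I * α * z + nonlinearPoly n c z := fun c => by
    ext z; exact planarPoly_eq _ n c z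
  obtain ⟨b, rfl⟩ := exists_coeff_eq N f
  have hF : ellipticMap α N (fun p => b p.1) =
      fun z => Complex.exp (Complex.I * α) * z + nonlinearPoly N b z := by
    ext z; exact planarPoly_eq _ N b z
  rw [hF]
  obtain ⟨c, φ, hφ, hO⟩ := exists_field_of_resonanceFactor_ne_zero hl
    (F := fun z => Complex.exp (Complex.I * α) * z + nonlinearPoly N b z)
    ((IsPolyFamily.var.coeff_mul continuous_const).add (isPlanarPoly_nonlinearPoly N b))
    ((nonlinearPoly_isBigO N b).congr_left fun z => by ring) (show 1 ≤ n by omega)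
  refine ⟨fun p => c p.1, ⟨φ, ?_, hO⟩, ?_⟩
  · rw [hfield]
    exact hφ.isUnitTimeFlowNearZero
  · rintro a ⟨ψ, hψ, hψO⟩
    obtain ⟨d, rfl⟩ := exists_coeff_eq n a
    rw [hfield] at hψ
    ext p
    obtain ⟨h1, h2⟩ := mem_nonlinearExponents.1 p.2
    exact coeff_eq_of_resonanceFactor_ne_zero hl hψ.isUnitFlow hφ
      ((hψO.sub hO).congr_left fun z => by ring) (show 1 ≤ n by omega) le_rfl p h1 h2

/-! ### The resonant case: zero and linear part of the field -/

/-- Two integral curves of a `C¹` field on an open set agree if they agree at the left end. -/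
lemma eqOn_of_integralCurves {U : Set ℂ} {X : ℂ → ℂ} (hU : IsOpen U) (hX : ContDiffOn ℝ 1 X U)
    {f g : ℝ → ℂ} {a b : ℝ}
    (hf : ∀ t ∈ Icc a b, HasDerivWithinAt f (X (f t)) (Icc a b) t) (hfU : ∀ t ∈ Icc a b, f t ∈ U)
    (hg : ∀ t ∈ Icc a b, HasDerivWithinAt g (X (g t)) (Icc a b) t) (hgU : ∀ t ∈ Icc a b, g t ∈ U)
    (h : f a = g a) : Set.EqOn f g (Icc a b) := by
  have hfc : ContinuousOn f (Icc a b) := fun t ht => (hf t ht).continuousWithinAt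
  have hgc : ContinuousOn g (Icc a b) := fun t ht => (hg t ht).continuousWithinAt
  -- Uniqueness requires one Lipschitz constant along both curves; their images are compact, so
  -- local Lipschitz bounds suffice.
  have hloc : LocallyLipschitzOn (f '' Icc a b ∪ g '' Icc a b) X := by
    intro x hx
    have hxU : x ∈ U := by
      rcases hx with ⟨t, ht, rfl⟩ | ⟨t, ht, rfl⟩
      exacts [hfU t ht, hgU t ht]
    obtain ⟨K, s, hs, hK⟩ := (hX.contDiffAt (hU.mem_nhds hxU)).exists_lipschitzOnWith
    exact ⟨K, s, mem_nhdsWithin_of_mem_nhds hs, hK⟩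
  obtain ⟨K, hK⟩ := hloc.exists_lipschitzOnWith_of_compact
    ((isCompact_Icc.image_of_continuousOn hfc).union (isCompact_Icc.image_of_continuousOn hgc))
  exact ODE_solution_unique_of_mem_Icc_right (v := fun _ => X) (fun _ _ => hK) hfc
    (fun t ht => (hf t ⟨ht.1, ht.2.le⟩).mono_of_mem_nhdsWithin (Icc_mem_nhdsGE_of_mem ht))
    (fun t ht => Or.inl ⟨t, ⟨ht.1, ht.2.le⟩, rfl⟩) hgc
    (fun t ht => (hg t ⟨ht.1, ht.2.le⟩).mono_of_mem_nhdsWithin (Icc_mem_nhdsGE_of_mem ht))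
    (fun t ht => Or.inr ⟨t, ⟨ht.1, ht.2.le⟩, rfl⟩) h

/-- If the time-one map fixes `0` and no other nearby point, then the field vanishes at `0`. -/
lemma field_zero_eq_zero {U : Set ℂ} {X : ℂ → ℂ} (hU : IsOpen U) (hX : ContDiffOn ℝ 1 X U)
    {φ : ℝ → ℂ → ℂ} (hφ : IsUnitTimeFlowNearZero U X φ) (h1 : φ 1 0 = 0)
    (hfix : ∀ᶠ w in 𝓝 (0 : ℂ), φ 1 w = w → w = 0) : X 0 = 0 := by
  obtain ⟨h00, h0U, h0d⟩ := hφ.self_of_nhds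
  have hd0 := h0d 0 (by simp)
  have hcont : Tendsto (fun t => φ t 0) (𝓝[Icc 0 1] 0) (𝓝 0) := by
    have := hd0.continuousWithinAt.tendsto
    rwa [h00] at this
  -- The time-one map commutes with the flow, so `φ s 0` is again a fixed point. For small `s` it is
  -- close to `0`, hence equal to `0`, and the orbit is stationary.
  have hzero : ∀ᶠ s in 𝓝[Icc (0 : ℝ) 1] 0, φ s 0 = 0 := by
    filter_upwards [hcont.eventually hfix, hcont.eventually hφ, self_mem_nhdsWithin]
      with s hs ⟨hw0, hwU, hwd⟩ hs01
    refine hs ?_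
    have shift : ∀ {a b r : ℝ}, 0 ≤ a → b ≤ 1 → 0 ≤ a + r → b + r ≤ 1 →
        φ a (φ s 0) = φ (a + r) 0 →
        ∀ t ∈ Icc a b, φ t (φ s 0) = φ (t + r) 0 := by
      intro a b r ha hb har hbr hab t ht
      refine eqOn_of_integralCurves hU hX (f := fun t => φ t (φ s 0))
        (g := fun t => φ (t + r) 0) ?_ ?_ ?_ ?_ hab ht
      · exact fun t ht => (hwd t ⟨ha.trans ht.1, ht.2.trans hb⟩).mono (Set.Icc_subset_Icc ha hb)
      · exact fun t ht => hwU t ⟨ha.trans ht.1, ht.2.trans hb⟩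
      · intro t ht
        have hmem : ∀ t ∈ Icc a b, t + r ∈ Icc (0 : ℝ) 1 :=
          fun t ht => ⟨by linarith [ht.1], by linarith [ht.2]⟩
        have hadd : HasDerivWithinAt (fun t => t + r) 1 (Icc a b) t :=
          ((hasDerivAt_id t).add_const r).hasDerivWithinAt
        exact ((h0d (t + r) (hmem t ht)).scomp t hadd hmem).congr_deriv (one_smul _ _)
      · exact fun t ht => h0U (t + r) ⟨by linarith [ht.1], by linarith [ht.2]⟩
    have e1 := shift (a := 0) (b := 1 - s) (r := s) le_rfl (by linarith [hs01.1])
      (by linarith [hs01.1]) (by linarith) (by simp [hw0]) (1 - s) ⟨by linarith [hs01.2], le_rfl⟩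
    rw [sub_add_cancel, h1] at e1
    -- The orbit of `φ s 0` reaches `φ 1 0 = 0` at time `1 - s`. In the remaining time `s` it
    -- retraces the orbit of `0` and ends at `φ s 0`.
    have e2 := shift (a := 1 - s) (b := 1) (r := s - 1) (by linarith [hs01.2]) le_rfl
      (by linarith) (by linarith [hs01.2]) (by rw [e1]; simp [h00]) 1
      ⟨by linarith [hs01.1], le_rfl⟩
    simpa using e2
  have hc : HasDerivWithinAt (fun _ : ℝ => (0 : ℂ)) (X (φ 0 0)) (Icc 0 1) 0 :=
    hd0.congr_of_eventuallyEq (hzero.mono fun s hs => hs.symm) (by simp [h00])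
  have := (uniqueDiffOn_Icc (zero_lt_one (α := ℝ)) 0 (by simp)).eq_deriv _ hc
    (hasDerivWithinAt_const _ _ _)
  rwa [h00] at this

/-- `T` is its own derivative at `0`, and the estimate makes this derivative zero. -/
lemma realLinear_eq_zero_of_isBigO {T : ℂ →L[ℝ] ℂ} (h : T =O[𝓝 0] fun z => ‖z‖ ^ 2) : T = 0 :=
  T.hasFDerivAt.unique (hasFDerivAt_zero_of_isBigO h)

/-- If the time-one map of `A z + R(z)` is tangent to a non-real rotation `w z`, then `A` is
complex linear. -/
lemma IsUnitFlow.linear_apply_eq_mul {A : ℂ →L[ℝ] ℂ} {R : ℂ → ℂ} {φ : ℝ → ℂ → ℂ}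
    (hR : IsQuadLipschitz R) (hφ : IsUnitFlow (fun z => A z + R z) φ) {w : ℂ} (hw : w.im ≠ 0)
    (h : (fun z => φ 1 z - w * z) =O[𝓝 0] fun z => ‖z‖ ^ 2) (z : ℂ) : A z = A 1 * z := by
  have hAO : (fun z => A z + R z) =O[𝓝 0] fun z => ‖z‖ := by
    refine ((A.isBigO_id _).norm_right).add (hR.isBigO.trans ?_)
    simpa using isBigO_norm_pow_of_le (k := 1) (m := 2) (by norm_num)
  have hφ1 := hφ.isBigO hAO
  -- The rotating coordinate again, with the operator exponential because `A` is so far only real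
  -- linear.
  set E : ℝ → ℂ →L[ℝ] ℂ := fun t => NormedSpace.exp (t • -A) with hE
  have hEd : ∀ t, HasDerivAt E (E t * -A) t := fun t => hasDerivAt_exp_smul_const (-A) t
  have hd : HasTimeDeriv (fun t z => E t (φ t z) - z) fun t z => E t (R (φ t z)) := by
    filter_upwards [hφ.hasTimeDeriv] with z hz t ht
    refine (((hEd t).hasDerivWithinAt.clm_apply (hz t ht)).sub_const z).congr_deriv ?_
    simp
  have hE1 : (fun p : ℂ × ℝ => E p.2) =O[unitTimes] fun _ => (1 : ℝ) := by
    obtain ⟨C, hC⟩ := isCompact_Icc.exists_bound_of_continuousOn (s := Icc (0 : ℝ) 1)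
      (f := E) fun t _ => (hEd t).continuousAt.continuousWithinAt
    refine IsBigO.of_bound C ?_
    rw [eventually_unitTimes]
    exact Eventually.of_forall fun z t ht => by simpa using hC t ht
  have hO := isBigO_at_one (f := fun t z => E t (φ t z) - z) (hd.isBigO_of_deriv' (m := 2)
    (by filter_upwards [hφ.map_zero] with z hz; simp [hz, hE]) (by
      have := hE1.norm_left.mul (isBigO_comp hR.isBigO hφ1).norm_left
      simp only [one_mul] at this
      exact IsBigO.trans (IsBigO.of_bound 1 (Eventually.of_forall fun p => by
        simpa using (E p.2).le_opNorm _)) this))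
  set L : ℂ →L[ℝ] ℂ := ContinuousLinearMap.mul ℝ ℂ w with hL
  -- Comparing first-order terms gives `exp(-A) w = 1`: multiplication by `w` is the inverse of
  -- `exp(-A)`, and so commutes with `A`.
  have hinv : E 1 * L - 1 = 0 := by
    refine realLinear_eq_zero_of_isBigO ?_
    refine (hO.sub (((E 1).isBigO_comp _ _).trans h)).congr_left fun z => ?_
    simp [hL, map_sub]
  have hcommE : Commute A (E 1) := by
    have : Commute A ((1 : ℝ) • -A) := by
      rw [one_smul]
      exact (Commute.refl A).neg_right
    exact this.exp_right
  have hEL : E 1 * L = 1 := sub_eq_zero.1 hinv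
  have hLE : L * E 1 = 1 := by
    have hw0 : w ≠ 0 := by rintro rfl; simp at hw
    set L' : ℂ →L[ℝ] ℂ := ContinuousLinearMap.mul ℝ ℂ w⁻¹ with hL'
    have hLL' : L * L' = 1 := by ext; simp [hL, hL', hw0]
    have : E 1 = L' := by
      calc E 1 = E 1 * (L * L') := by rw [hLL', mul_one]
        _ = L' := by rw [← mul_assoc, hEL, one_mul]
    rw [this, hLL']
  have hAL : A * L = L * A := by
    calc A * L = (L * E 1) * (A * L) := by rw [hLE, one_mul]
      _ = L * ((A * E 1) * L) := by rw [hcommE.eq]; simp only [mul_assoc]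
      _ = L * A := by rw [mul_assoc A, hEL, mul_one]
  have hw1 : A w = w * A 1 := by
    simpa [hL] using congrArg (fun T : ℂ →L[ℝ] ℂ => T 1) hAL
  -- Since `w` is not real, `1` and `w` span the plane over the reals, so `A w = w A 1` determines
  -- `A` at `i`.
  have hI : A Complex.I = Complex.I * A 1 := by
    rw [realLinear_apply A w] at hw1
    have hwim : (w.im : ℂ) ≠ 0 := by exact_mod_cast hw
    refine mul_left_cancel₀ hwim ?_
    have := Complex.re_add_im w
    linear_combination hw1 - A 1 * this
  rw [realLinear_apply A z, hI]
  linear_combination A 1 * Complex.re_add_im z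

/-! ### The resonant case: the obstruction in degree `n` -/

/-- The linear flow. -/
lemma isUnitFlow_linear (l : ℂ) :
    IsUnitFlow (fun z => l * z + 0) fun t z => Complex.exp (l * t) * z := by
  refine ⟨Eventually.of_forall fun z => by simp, Eventually.of_forall fun z t _ => ?_⟩
  have h1 : HasDerivAt (fun t : ℝ => Complex.exp (l * t)) (Complex.exp (l * t) * l) t := by
    simpa using ((Complex.ofRealCLM.hasDerivAt (x := t)).const_mul l).cexp
  exact (h1.mul_const z).hasDerivWithinAt.congr_deriv (by ring)

lemma isQuadLipschitz_zero : IsQuadLipschitz fun _ => 0 :=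
  ⟨rfl, (isBigO_zero _ _).congr_left fun _ => by simp⟩

/-- If the field is linear up to order `k` then its degree `k` part is seen in the time-one map
through the resonance factors. -/
lemma IsUnitFlow.isBigO_sub_linear_sub_homPoly {l : ℂ} {R : ℂ → ℂ} {φ : ℝ → ℂ → ℂ}
    (hφ : IsUnitFlow (fun z => l * z + R z) φ) (hR : IsQuadLipschitz R) {k : ℕ} (hk : k ≠ 0)
    {c : ℕ × ℕ → ℂ} (h : (fun z => R z - homPoly k c z) =O[𝓝 0] fun z => ‖z‖ ^ (k + 1)) :
    (fun z => φ 1 z - Complex.exp l * z -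
      homPoly k (Complex.exp l • fun p => c p * resonanceFactor l p) z) =O[𝓝 0]
      fun z => ‖z‖ ^ (k + 1) := by
  obtain ⟨m, rfl⟩ := Nat.exists_eq_succ_of_ne_zero hk
  refine (hφ.isBigO_sub_homPoly (isUnitFlow_linear l) hR isQuadLipschitz_zero (m := m) (c := c)
    (h.congr_left fun z => by ring)).congr_left fun z => ?_
  rw [homPoly_smul]
  simp

/-- If the resonance factors below degree `n` do not vanish, the time-one map cannot be linear up
to degree `n` with a term `z̄^n` whose resonance factor vanishes. -/
lemma not_isUnitFlow_of_resonance {l : ℂ} {R : ℂ → ℂ} {φ : ℝ → ℂ → ℂ} {n : ℕ} (hn : 2 ≤ n)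
    (hφ : IsUnitFlow (fun z => l * z + R z) φ) (hR : IsQuadLipschitz R)
    (hRC : ContDiffAt ℝ (n + 1 : ℕ) R 0)
    (hres : ∀ p : ℕ × ℕ, p.1 + p.2 < n → resonanceFactor l p ≠ 0)
    (hres0 : resonanceFactor l (0, n) = 0)
    (h : (fun z => φ 1 z - (Complex.exp l * z + conj z ^ n)) =O[𝓝 0] fun z => ‖z‖ ^ (n + 1)) :
    False := by
  obtain ⟨P, hP, hRP⟩ := hRC.exists_isPlanarPoly
  have hn_conj : (fun z : ℂ => conj z ^ n) =O[𝓝 0] fun z => ‖z‖ ^ n :=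
    IsBigO.of_bound 1 (Eventually.of_forall fun z => by simp)
  have hlin : (fun z => φ 1 z - Complex.exp l * z) =O[𝓝 0] fun z => ‖z‖ ^ n :=
    ((h.trans (isBigO_norm_pow_of_le (by omega))).add hn_conj).congr_left fun z => by ring
  have hstep : ∀ k ≤ n, R =O[𝓝 0] (fun z => ‖z‖ ^ k) → ∃ c : ℕ × ℕ → ℂ,
      (fun z => R z - homPoly k c z) =O[𝓝 0] fun z => ‖z‖ ^ (k + 1) := by
    intro k hk hRk
    obtain ⟨c, hc⟩ := hP.exists_homPoly (m := k)
      ((hRk.sub (hRP.trans (isBigO_norm_pow_of_le (by omega)))).congr_left fun z => by ring)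
    exact ⟨c, (hc.add (hRP.trans (isBigO_norm_pow_of_le (by omega)))).congr_left
      fun z => by ring⟩
  -- Below degree `n` the time-one map is linear and the factors are nonzero, so each homogeneous
  -- part of `R` vanishes in turn.
  have hRn : ∀ k, 2 ≤ k → k ≤ n → R =O[𝓝 0] fun z => ‖z‖ ^ k := by
    intro k hk
    induction k, hk using Nat.le_induction with
    | base => exact fun _ => hR.isBigO
    | succ k hk ih =>
      intro hkn
      obtain ⟨c, hc⟩ := hstep k (by omega) (ih (by omega))
      have h1 := hφ.isBigO_sub_linear_sub_homPoly hR (by omega) hc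
      have h2 := ((hlin.trans (isBigO_norm_pow_of_le hkn)).sub h1).congr_left
        (f₂ := homPoly k (Complex.exp l • fun p => c p * resonanceFactor l p)) fun z => by ring
      have hc0 : ∀ p ∈ Finset.HasAntidiagonal.antidiagonal k, c p = 0 := by
        intro p hp
        have hpk := Finset.HasAntidiagonal.mem_antidiagonal.1 hp
        simpa [hres p (by omega), Complex.exp_ne_zero] using coeff_eq_zero_of_isBigO h2 p hp
      refine hc.congr_left fun z => ?_
      rw [homPoly_congr (d := 0) hc0]
      simp [homPoly]
  obtain ⟨c, hc⟩ := hstep n le_rfl (hRn n hn le_rfl)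
  have h1 := hφ.isBigO_sub_linear_sub_homPoly hR (by omega) hc
  -- In degree `n` the coefficient of `z̄^n` is `1` in the map, but the field contributes a multiple
  -- of `resonanceFactor l (0, n) = 0`.
  have h2 := (h1.sub h).congr_left
    (f₂ := homPoly n (Pi.single (0, n) 1 -
      Complex.exp l • fun p => c p * resonanceFactor l p)) fun z => by
      rw [homPoly_sub]
      have := homPoly_single 0 n 1 z
      rw [zero_add] at this
      rw [this]
      ring
  have := coeff_eq_zero_of_isBigO h2 (0, n) (by simp)
  simp [hres0] at this

/-- The integer `k` is the branch of the logarithm, since the time-one map fixes `l` only modulo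
`2πi`. As `1 + k (n+1)` is congruent to `1` modulo `n + 1`, a resonance at `p` means that `n + 1`
divides `p.1 - p.2 - 1`. Below degree `n` this number has absolute value at most `n`; at `(0, n)` it
equals `-(n+1)`. -/
lemma resonance_of_exp_eq {n : ℕ} (hn : n ≠ 0) {l : ℂ} {k : ℤ}
    (hl : l = 2 * Real.pi * Complex.I * (1 + k * (n + 1)) / (n + 1)) :
    (∀ p : ℕ × ℕ, p.1 + p.2 < n → resonanceFactor l p ≠ 0) ∧ resonanceFactor l (0, n) = 0 := by
  have hn1 : (n : ℂ) + 1 ≠ 0 := by exact_mod_cast n.succ_ne_zero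
  have hpi : (2 * Real.pi * Complex.I : ℂ) ≠ 0 := Complex.two_pi_I_ne_zero
  have hconj : conj l = -l := by
    have h2 : conj (2 : ℂ) = 2 := map_ofNat _ 2
    rw [hl]
    simp only [map_div₀, map_mul, map_add, map_one, h2, Complex.conj_ofReal, Complex.conj_I,
      map_natCast, map_intCast]
    ring
  have hμ : ∀ p : ℕ × ℕ, l * p.1 + conj l * p.2 - l =
      2 * Real.pi * Complex.I * ((1 + k * (n + 1)) * (p.1 - p.2 - 1)) / (n + 1) := by
    intro p
    rw [hconj, hl]; ring
  constructor
  · intro p hp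
    refine resonanceFactor_ne_zero _ _ fun h => ?_
    rw [Complex.exp_eq_one_iff] at h
    obtain ⟨j, hj⟩ := h
    rw [hμ p] at hj ⊢
    have hj' : (1 + k * (n + 1)) * ((p.1 : ℤ) - p.2 - 1) = j * (n + 1) := by
      rw [div_eq_iff hn1] at hj
      have : (2 * Real.pi * Complex.I : ℂ) * ((1 + k * (n + 1)) * (p.1 - p.2 - 1)) =
        2 * Real.pi * Complex.I * (j * (n + 1)) := by rw [hj]; ring
      exact_mod_cast mul_left_cancel₀ hpi this
    have hdvd : ((n : ℤ) + 1) ∣ (p.1 : ℤ) - p.2 - 1 :=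
      ⟨j - k * ((p.1 : ℤ) - p.2 - 1), by linear_combination hj'⟩
    have hz : (p.1 : ℤ) - p.2 - 1 = 0 :=
      Int.eq_zero_of_abs_lt_dvd hdvd (by rw [abs_lt]; omega)
    have hz' : (p.1 : ℂ) - p.2 - 1 = 0 := by exact_mod_cast hz
    simp [hz']
  · have hval : l * ((0, n) : ℕ × ℕ).1 + conj l * ((0, n) : ℕ × ℕ).2 - l =
        ((-(1 + k * (n + 1)) : ℤ) : ℂ) * (2 * Real.pi * Complex.I) := by
      rw [hμ]
      push_cast
      field_simp
      ring
    rw [resonanceFactor_eq, hval, Complex.exp_int_mul_two_pi_mul_I, sub_self, zero_div]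
    rw [hval]
    refine mul_ne_zero ?_ hpi
    refine Int.cast_ne_zero.2 (neg_ne_zero.2 fun h => ?_)
    -- The exponent at `(0, n)` must itself be nonzero, otherwise the factor would be `1`; it could
    -- vanish only if `n + 1` divided `1`.
    have : ((n : ℤ) + 1) ∣ 1 := ⟨-k, by linear_combination h⟩
    have := Int.le_of_dvd one_pos this
    omega

/-- `exp(2πi/(n+1)) z + z̄^n` is not the time-one map of a `C^(n+1)` field up to order `n`. -/
theorem not_timeOneMap_of_resonance {n : ℕ} (hn : 2 ≤ n) {U : Set ℂ} {X : ℂ → ℂ} (hU : IsOpen U)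
    (h0 : (0 : ℂ) ∈ U) (hX : ContDiffOn ℝ (n + 1 : ℕ) X U) :
    ¬ TimeOneMapAgreesToOrder U X
      (fun z => Complex.exp (2 * Real.pi * Complex.I / (n + 1)) * z + conj z ^ n) n := by
  rintro ⟨φ, hφ, hO⟩
  set w := Complex.exp (2 * Real.pi * Complex.I / (n + 1)) with hw
  have hn1 : (n : ℂ) + 1 ≠ 0 := by exact_mod_cast n.succ_ne_zero
  -- For `n ≥ 2` the angle `2π/(n+1)` lies strictly between `0` and `π`.
  have hwim : w.im ≠ 0 := by
    have harg : (2 * Real.pi * Complex.I / (n + 1) : ℂ) =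
        ((2 * Real.pi / (n + 1) : ℝ) : ℂ) * Complex.I := by push_cast; ring
    rw [hw, harg, Complex.exp_ofReal_mul_I_im]
    refine (Real.sin_pos_of_pos_of_lt_pi (by positivity) ?_).ne'
    have : (2 : ℝ) ≤ n := by exact_mod_cast hn
    rw [div_lt_iff₀ (by positivity)]
    nlinarith [Real.pi_pos]
  have hn_conj : (fun z : ℂ => conj z ^ n) =O[𝓝 0] fun z => ‖z‖ ^ n :=
    IsBigO.of_bound 1 (Eventually.of_forall fun z => by simp)
  have hw2 : (fun z => φ 1 z - w * z) =O[𝓝 0] fun z => ‖z‖ ^ 2 :=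
    ((hO.trans (isBigO_norm_pow_of_le (by omega))).add
      (hn_conj.trans (isBigO_norm_pow_of_le hn))).congr_left fun z => by ring
  have hφ10 : φ 1 0 = 0 := by
    simpa using eq_zero_of_isBigO_norm_pow two_ne_zero hw2
  -- A fixed point satisfies `‖1 - w‖ ‖z‖ ≤ C ‖z‖²`, which is impossible for small nonzero `z`.
  have hfix : ∀ᶠ z in 𝓝 (0 : ℂ), φ 1 z = z → z = 0 := by
    have h1w : 0 < ‖1 - w‖ := norm_pos_iff.2 fun h => hwim (by
      rw [← sub_eq_zero.1 h]; simp)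
    obtain ⟨C, hC, hb⟩ := hw2.exists_pos
    have hsmall : ∀ᶠ z in 𝓝 (0 : ℂ), C * ‖z‖ < ‖1 - w‖ := by
      have : Continuous fun z : ℂ => C * ‖z‖ := by fun_prop
      exact this.continuousAt.eventually_lt continuousAt_const (by simpa using h1w)
    filter_upwards [hb.bound, hsmall] with z hz hzs hfz
    by_contra hz0
    have hzpos := norm_pos_iff.2 hz0
    rw [hfz, ← one_sub_mul, norm_mul, norm_pow, norm_norm] at hz
    nlinarith
  have hX1 : ContDiffOn ℝ 1 X U := hX.of_le (by norm_cast; omega)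
  have hX0 := field_zero_eq_zero hU hX1 hφ hφ10 hfix
  have hXat : ContDiffAt ℝ (n + 1 : ℕ) X 0 := hX.contDiffAt (hU.mem_nhds h0)
  set A := fderiv ℝ X 0 with hA
  set R : ℂ → ℂ := fun z => X z - A z with hRdef
  have hRC : ContDiffAt ℝ (n + 1 : ℕ) R 0 := hXat.sub A.contDiff.contDiffAt
  have hRd : fderiv ℝ R 0 = 0 := by
    have := ((hXat.differentiableAt (by norm_cast)).hasFDerivAt.sub A.hasFDerivAt).fderiv
    rw [← hA, sub_self] at this
    exact this
  have hR : IsQuadLipschitz R :=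
    isQuadLipschitz_of_contDiffAt (hRC.of_le (by norm_cast; omega)) (by simp [hRdef, hX0]) hRd
  have hAmul := IsUnitFlow.linear_apply_eq_mul (A := A) hR
    (by simpa [hRdef] using hφ.isUnitFlow) hwim hw2
  have hflow : IsUnitFlow (fun z => A 1 * z + R z) φ := by
    simpa [hRdef, ← hAmul] using hφ.isUnitFlow
  have hexp : Complex.exp (A 1) = w := by
    have h1 := isBigO_at_one (f := fun t z => φ t z - Complex.exp (A 1 * t) * z)
      (hflow.isBigO_sub_linear hR hR.isBigO)
    have h2 := realLinear_eq_zero_of_isBigO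
      (T := ContinuousLinearMap.mul ℝ ℂ (Complex.exp (A 1) - w))
      ((hw2.sub h1).congr_left fun z => by simp)
    have := congrArg (fun T : ℂ →L[ℝ] ℂ => T 1) h2
    simpa [sub_eq_zero] using this
  obtain ⟨k, hk⟩ := Complex.exp_eq_exp_iff_exists_int.1 (hexp.trans hw)
  obtain ⟨hres, hres0⟩ := resonance_of_exp_eq (n := n) (by omega) (l := A 1) (k := k)
    (by rw [hk]; field_simp)
  exact not_isUnitFlow_of_resonance hn hflow hR hRC hres hres0 (by rw [hexp]; exact hO)

lemma exists_ellipticMap_eq {n : ℕ} (hn : 2 ≤ n) :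
    ∃ f : nonlinearExponents n → ℂ, ∀ z : ℂ, ellipticMap (2 * Real.pi / (n + 1)) n f z =
      Complex.exp (2 * Real.pi * Complex.I / (n + 1)) * z + conj z ^ n := by
  refine ⟨fun p => (Pi.single (0, n) 1 : ℕ × ℕ → ℂ) p.1, fun z => ?_⟩
  rw [ellipticMap, planarPoly_eq, nonlinearPoly, Finset.sum_eq_single_of_mem n (by simp [hn])]
  · have := homPoly_single 0 n 1 z
    rw [zero_add] at this
    rw [this]
    congr 2
    · congr 1; push_cast; ring
    · ring
  · intro k _ hk
    refine Finset.sum_eq_zero fun p hp => ?_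
    rw [Pi.single_eq_of_ne]
    · simp
    · rintro rfl
      exact hk (by simpa using (Finset.HasAntidiagonal.mem_antidiagonal.1 hp).symm)

end

theorem theoremp :
    (∀ (α : ℝ), α ∈ Set.Ioo 0 (2 * Real.pi) →
      (∀ m : ℕ, 1 ≤ m → Complex.exp (Complex.I * α) ^ m ≠ 1) →
      ∀ (N : ℕ) (f : nonlinearExponents N → ℂ) (n : ℕ), 2 ≤ n →
        ∃! a : nonlinearExponents n → ℂ,
          TimeOneMapAgreesToOrder Set.univ (ellipticField α n a) (ellipticMap α N f) n) ∧
    (∀ n : ℕ, 2 ≤ n →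
      ∃ f : nonlinearExponents n → ℂ,
        (∀ z : ℂ, ellipticMap (2 * Real.pi / (n + 1)) n f z =
          Complex.exp (2 * Real.pi * Complex.I / (n + 1)) * z + conj z ^ n) ∧
        ¬ ∃ (U : Set ℂ) (X : ℂ → ℂ), IsOpen U ∧ (0 : ℂ) ∈ U ∧
          ContDiffOn ℝ ((n + 1 : ℕ) : WithTop ℕ∞) X U ∧
          TimeOneMapAgreesToOrder U X
            (ellipticMap (2 * Real.pi / (n + 1)) n f) n) := by
  refine ⟨fun α _ hroot N f n hn => existsUnique_ellipticField hroot N f n hn, fun n hn => ?_⟩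
  obtain ⟨f, hf⟩ := exists_ellipticMap_eq hn
  refine ⟨f, hf, ?_⟩
  rintro ⟨U, X, hU, h0, hX, h⟩
  rw [funext hf] at h
  exact not_timeOneMap_of_resonance hn hU h0 hX h
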